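/- Let $\mathbb{T}^2$ be the simplicial complex on the vertices $v_1,\dots,v_7$ whose maximal simplices are the 14 triangles $$v_1v_2v_4,\ v_2v_4v_5,\ v_2v_3v_5,\ v_3v_5v_6,\ v_1v_5v_6,\ v_1v_2v_6,\ v_2v_6v_7,\ v_2v_3v_7,\ v_1v_3v_7,\ v_1v_5v_7,\ v_4v_5v_7,\ v_4v_6v_7,\ v_3v_4v_6,\ v_1v_3v_4.$$ For an integer $g\ge 0$, a *triangulated orientable surface of genus $g$* is a finite connected two-dimensional simplicial complex all of whose vertex links are cycles, whose triangles can be coherently oriented, and with $\operatorname{rank} H_1(K;\mathbb{Z})=2g$; then $H_2(K;\mathbb{Z})\cong\mathbb{Z}$, and an orientation of $K$ is a choice of a generator $[K]$ of this group. A simplicial map $f:K\to L$ between two oriented triangulated surfaces has degree $d\in\mathbb{Z}$ if $f_*[K]=d\,[L]$ in simplicial homology. **Theorem.** $\mathbb{T}^2$ is a triangulated orientable surface of genus $1$. Let $g\ge 1$ be an integer and let $d$ be an integer with $|d|\ge 2g-1$. Then: 1. for each orientation of $\mathbb{T}^2$, there are an oriented triangulated orientable surface $K$ of genus $g$ with exactly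 $7|d|+2-2g$ vertices and a simplicial map $f:K\to\mathbb{T}^2$ of degree $d$ that is onto (every simplex of $\mathbb{T}^2$ is the image of a simplex of $K$); 2. this is minimal: if $K$ is any oriented triangulated orientable surface of genus $g$ that admits a simplicial map of degree $d$ to $\mathbb{T}^2$ (with either orientation), then $K$ has at least $14|d|$ triangles and at least $7|d|+2-2g$ vertices. -/

import Mathlib

namespace TriSurf

open Finset

/-! ### Oriented simplicial homology of a finite simplicial complex -/

section Homology

variable {V : Type*} [DecidableEq V]

/-- Oriented simplicial `n`-chains of `K` with integer coefficients: functions `c` on ordered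
`(n+1)`-tuples of vertices with `c (v ∘ σ) = sign σ * c v`, supported on tuples spanning a face.
Such a `c` vanishes on tuples with a repetition, so it is a function on oriented `n`-simplices
that changes sign with the orientation. -/
def Chains (K : AbstractSimplicialComplex V) (n : ℕ) : Submodule ℤ ((Fin (n + 1) → V) → ℤ) where
  carrier := {c | (∀ (σ : Equiv.Perm (Fin (n + 1))) (v : Fin (n + 1) → V),
      c (v ∘ σ) = (Equiv.Perm.sign σ : ℤ) * c v) ∧
    ∀ v, c v ≠ 0 → univ.image v ∈ K.faces}
  zero_mem' := by simp
  add_mem' := by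
    rintro a b ⟨ha, ha'⟩ ⟨hb, hb'⟩
    refine ⟨fun σ v => by simp [ha, hb, mul_add], fun v hv => ?_⟩
    by_cases h : a v = 0
    · exact hb' v (by simpa [h] using hv)
    · exact ha' v h
  smul_mem' := by
    rintro r a ⟨ha, ha'⟩
    refine ⟨fun σ v => by simp [ha, mul_left_comm], fun v hv => ha' v ?_⟩
    intro h
    simp [h] at hv

theorem eq_zero_of_not_injective {K : AbstractSimplicialComplex V} {n : ℕ}
    (c : Chains K n) {v : Fin (n + 1) → V} (hv : ¬ Function.Injective v) : c.1 v = 0 := by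
  simp only [Function.Injective, not_forall] at hv
  obtain ⟨i, j, h, hij⟩ := hv
  have h1 := c.2.1 (Equiv.swap i j) v
  have h2 : v ∘ (Equiv.swap i j) = v := by
    funext k
    simp only [Function.comp, Equiv.swap_apply_def]
    split_ifs <;> simp_all
  rw [h2, Equiv.Perm.sign_swap hij] at h1
  push_cast at h1
  linarith

variable [Fintype V]

/-- The simplicial boundary `∂[v₀ … vₙ₊₁] = ∑ (-1)^i [v₀ … v̂ᵢ … vₙ₊₁]`: the coefficient of
`[v₀ … vₙ]` in `∂ c` is the sum over all vertices `w` of the coefficient of `[w v₀ … vₙ]`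
in `c`. -/
def boundary (K : AbstractSimplicialComplex V) (n : ℕ) : Chains K (n + 1) →ₗ[ℤ] Chains K n where
  toFun c := ⟨fun v => ∑ w : V, c.1 (Fin.cons w v), by
    refine ⟨fun σ v => ?_, fun v hv => ?_⟩
    · rw [Finset.mul_sum]
      refine Finset.sum_congr rfl fun w _ => ?_
      have h := c.2.1 (Equiv.Perm.decomposeFin.symm (0, σ)) (Fin.cons w v)
      rw [Equiv.Perm.decomposeFin.symm_sign] at h
      simp only [if_true, one_mul] at h
      rw [← h]
      refine congrArg c.1 (funext fun i => ?_)
      refine Fin.cases ?_ (fun i => ?_) i <;> simp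
    · obtain ⟨w, -, hw⟩ := Finset.exists_ne_zero_of_sum_ne_zero hv
      refine (K.isRelLowerSet_faces (c.2.2 _ hw)).2 (fun x hx => ?_) (by simp)
      obtain ⟨i, -, rfl⟩ := Finset.mem_image.1 hx
      exact Finset.mem_image.2 ⟨i.succ, by simp, by simp⟩⟩
  map_add' a b := by
    ext v
    simp [Finset.sum_add_distrib]
  map_smul' r a := by
    ext v
    simp [Finset.mul_sum]

theorem boundary_boundary (K : AbstractSimplicialComplex V) (n : ℕ) (c : Chains K (n + 2)) :
    boundary K n (boundary K (n + 1) c) = 0 := by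
  ext v
  change ∑ w : V, ∑ u : V, c.1 (Fin.cons u (Fin.cons w v)) = 0
  have key : ∀ u w : V, c.1 (Fin.cons u (Fin.cons w v)) = -c.1 (Fin.cons w (Fin.cons u v)) := by
    intro u w
    have h := c.2.1 (Equiv.swap 0 1) (Fin.cons w (Fin.cons u v))
    rw [Equiv.Perm.sign_swap (by simp)] at h
    push_cast at h
    rw [neg_one_mul] at h
    rw [← h]
    refine congrArg c.1 (funext fun i => ?_)
    refine Fin.cases ?_ (fun i => Fin.cases ?_ (fun i => ?_) i) i
    · simp
    · simp
    · have h0 : (i.succ.succ : Fin (n + 3)) ≠ 0 := Fin.succ_ne_zero _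
      have h1 : (i.succ.succ : Fin (n + 3)) ≠ 1 := fun h =>
        Fin.succ_ne_zero i (Fin.succ_injective _ (h.trans Fin.succ_zero_eq_one.symm))
      simp [Equiv.swap_apply_of_ne_of_ne h0 h1]
  have h : ∑ w : V, ∑ u : V, c.1 (Fin.cons u (Fin.cons w v)) =
      -∑ w : V, ∑ u : V, c.1 (Fin.cons u (Fin.cons w v)) := by
    conv_lhs => rw [Finset.sum_comm]
    rw [← Finset.sum_neg_distrib]
    refine Finset.sum_congr rfl fun u _ => ?_
    rw [← Finset.sum_neg_distrib]
    exact Finset.sum_congr rfl fun w _ => key u w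
  linarith

/-- The `n`-cycles of `K`; every `0`-chain is a cycle. -/
def cycles (K : AbstractSimplicialComplex V) : (n : ℕ) → Submodule ℤ (Chains K n)
  | 0 => ⊤
  | n + 1 => LinearMap.ker (boundary K n)

/-- The `n`-boundaries of `K`. -/
def boundaries (K : AbstractSimplicialComplex V) (n : ℕ) : Submodule ℤ (Chains K n) :=
  LinearMap.range (boundary K n)

theorem boundaries_le_cycles (K : AbstractSimplicialComplex V) (n : ℕ) :
    boundaries K n ≤ cycles K n := by
  rintro _ ⟨c, rfl⟩
  cases n with
  | zero => trivial
  | succ n => exact boundary_boundary K n c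

/-- The `n`-th simplicial homology group `Hₙ(K; ℤ)`: cycles modulo boundaries. -/
abbrev Homology (K : AbstractSimplicialComplex V) (n : ℕ) : Type _ :=
  cycles K n ⧸ (boundaries K n).submoduleOf (cycles K n)

end Homology

/-! ### Simplicial maps and induced maps in homology -/

/-- A simplicial map: a map of vertices carrying every simplex onto a simplex. -/
structure SimplicialMap {V W : Type*} [DecidableEq W]
    (K : AbstractSimplicialComplex V) (L : AbstractSimplicialComplex W) where
  toFun : V → W
  map_face : ∀ s ∈ K.faces, s.image toFun ∈ L.faces

namespace SimplicialMap

variable {V W : Type*} [DecidableEq W]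
  {K : AbstractSimplicialComplex V} {L : AbstractSimplicialComplex W}

/-- Every simplex of the target is the image of a simplex of the source. -/
def IsOnto (f : SimplicialMap K L) : Prop :=
  ∀ t ∈ L.faces, ∃ s ∈ K.faces, s.image f.toFun = t

variable [Fintype V] [DecidableEq V] [Fintype W]

/-- The induced chain map `[v₀ … vₙ] ↦ [f v₀ … f vₙ]`, where the image is `0` if two of the
vertices `f vᵢ` coincide: the coefficient of `[w₀ … wₙ]` in `f_# c` is the sum of the coefficients
in `c` of all `[v₀ … vₙ]` with `f vᵢ = wᵢ` for all `i`. -/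
def chainMap (f : SimplicialMap K L) (n : ℕ) : Chains K n →ₗ[ℤ] Chains L n where
  toFun c := ⟨fun w => ∑ v : Fin (n + 1) → V, if f.toFun ∘ v = w then c.1 v else 0, by
    refine ⟨fun σ w => ?_, fun w hw => ?_⟩
    · rw [Finset.mul_sum]
      refine (Fintype.sum_equiv (σ.arrowCongr (Equiv.refl V)) _ _ fun v => ?_)
      have h1 : (σ.arrowCongr (Equiv.refl V)) v = v ∘ σ.symm := rfl
      have h2 : f.toFun ∘ v ∘ σ.symm = w ↔ f.toFun ∘ v = w ∘ σ := by
        constructor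
        · rintro rfl
          funext i
          simp
        · intro h
          funext i
          simpa using congrFun h (σ.symm i)
      rw [h1]
      simp only [h2]
      split_ifs
      · have := c.2.1 σ (v ∘ σ.symm)
        rw [← this]
        refine congrArg c.1 (funext fun i => ?_)
        simp
      · simp
    · obtain ⟨v, -, hv⟩ := Finset.exists_ne_zero_of_sum_ne_zero hw
      split_ifs at hv with h
      · have := f.map_face _ (c.2.2 v hv)
        rwa [Finset.image_image, h] at this
      · exact absurd rfl hv⟩
  map_add' a b := by
    ext w
    simp only [Submodule.coe_add, Pi.add_apply, ← Finset.sum_add_distrib]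
    refine Finset.sum_congr rfl fun v _ => ?_
    split_ifs <;> simp
  map_smul' r a := by
    ext w
    simp [Finset.mul_sum]

theorem boundary_chainMap (f : SimplicialMap K L) (n : ℕ) (c : Chains K (n + 1)) :
    boundary L n (f.chainMap (n + 1) c) = f.chainMap n (boundary K n c) := by
  ext w
  change ∑ x : W, ∑ v : Fin (n + 2) → V, (if f.toFun ∘ v = Fin.cons x w then c.1 v else 0) =
    ∑ v : Fin (n + 1) → V, if f.toFun ∘ v = w then ∑ y : V, c.1 (Fin.cons y v) else 0
  rw [Finset.sum_comm]
  have e := (Fin.consEquiv (fun _ : Fin (n + 2) => V)).sum_comp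
    (fun v => ∑ x : W, if f.toFun ∘ v = Fin.cons x w then c.1 v else 0)
  rw [← e, Fintype.sum_prod_type, Finset.sum_comm]
  refine Finset.sum_congr rfl fun v _ => ?_
  have h : ∀ (y : V) (x : W), (f.toFun ∘ (Fin.cons y v : Fin (n + 2) → V) = Fin.cons x w) ↔
      (f.toFun y = x ∧ f.toFun ∘ v = w) := by
    intro y x
    constructor
    · intro h
      refine ⟨by simpa using congrFun h 0, ?_⟩
      funext i
      simpa using congrFun h i.succ
    · rintro ⟨rfl, rfl⟩
      funext i
      refine Fin.cases ?_ (fun i => ?_) i <;> simp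
  by_cases hw : f.toFun ∘ v = w
  · simp only [hw, if_true]
    refine Finset.sum_congr rfl fun y _ => ?_
    change (∑ x : W, if f.toFun ∘ (Fin.cons y v : Fin (n + 2) → V) = Fin.cons x w
      then c.1 (Fin.cons y v) else 0) = _
    simp [h, hw]
  · simp only [hw, if_false]
    refine Finset.sum_eq_zero fun y _ => ?_
    change (∑ x : W, if f.toFun ∘ (Fin.cons y v : Fin (n + 2) → V) = Fin.cons x w
      then c.1 (Fin.cons y v) else 0) = _
    simp [h, hw]

theorem chainMap_mem_cycles (f : SimplicialMap K L) (n : ℕ) {c : Chains K n}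
    (hc : c ∈ cycles K n) : f.chainMap n c ∈ cycles L n := by
  cases n with
  | zero => trivial
  | succ n =>
    change boundary L n (f.chainMap (n + 1) c) = 0
    rw [boundary_chainMap, show boundary K n c = 0 from hc, map_zero]

/-- The chain map restricted to cycles. -/
def cyclesMap (f : SimplicialMap K L) (n : ℕ) : cycles K n →ₗ[ℤ] cycles L n :=
  (f.chainMap n).restrict fun _ hc => f.chainMap_mem_cycles n hc

theorem cyclesMap_boundaries (f : SimplicialMap K L) (n : ℕ) :
    (boundaries K n).submoduleOf (cycles K n) ≤
      ((boundaries L n).submoduleOf (cycles L n)).comap (f.cyclesMap n) := by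
  rintro ⟨c, hc⟩ ⟨b, hb⟩
  exact ⟨f.chainMap (n + 1) b, by
    rw [boundary_chainMap, hb]
    rfl⟩

/-- The induced homomorphism `f_* : Hₙ(K; ℤ) → Hₙ(L; ℤ)`. -/
def homologyMap (f : SimplicialMap K L) (n : ℕ) : Homology K n →ₗ[ℤ] Homology L n :=
  Submodule.mapQ _ _ (f.cyclesMap n) (f.cyclesMap_boundaries n)

/-- `f` has degree `d` with respect to the classes `a`, `b` (the fundamental classes of two oriented
closed surfaces): `f_* a = d • b` in `H₂`. -/
def HasDegree (f : SimplicialMap K L) (a : Homology K 2) (b : Homology L 2) (d : ℤ) : Prop :=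
  f.homologyMap 2 a = d • b

end SimplicialMap

/-! ### Triangulated closed orientable surfaces -/

section Surface

variable {V : Type*}

/-- The triangles (`2`-simplices) of `K`. -/
def triangles (K : AbstractSimplicialComplex V) : Set (Finset V) :=
  {s | s ∈ K.faces ∧ s.card = 3}

variable [DecidableEq V]

/-- The `1`-skeleton of `K`. -/
def edgeGraph (K : AbstractSimplicialComplex V) : SimpleGraph V where
  Adj x y := x ≠ y ∧ {x, y} ∈ K.faces
  symm := ⟨fun x y h => ⟨h.1.symm, by rw [Finset.pair_comm]; exact h.2⟩⟩
  loopless := ⟨fun _ h => h.1 rfl⟩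

/-- The link of the vertex `v` in a complex of dimension at most two, as a graph: its vertices are
the neighbours of `v`, its edges are the pairs `{x, y}` that form a triangle with `v`. -/
def linkGraph (K : AbstractSimplicialComplex V) (v : V) :
    SimpleGraph {x : V // x ≠ v ∧ {v, x} ∈ K.faces} where
  Adj x y := x ≠ y ∧ {v, x.1, y.1} ∈ K.faces
  symm := ⟨fun x y h => ⟨h.1.symm, by rw [Finset.pair_comm]; exact h.2⟩⟩
  loopless := ⟨fun _ h => h.1 rfl⟩

/-- A (finite) connected simplicial complex of dimension two all of whose vertex links are cycles,
that is, a triangulated connected closed surface. A cycle is a finite connected graph in which every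
vertex has exactly two neighbours. -/
structure IsClosedSurface [Fintype V] (K : AbstractSimplicialComplex V) : Prop where
  card_le_three : ∀ s ∈ K.faces, s.card ≤ 3
  connected : (edgeGraph K).Connected
  link_connected : ∀ v, (linkGraph K v).Connected
  link_degree : ∀ v x, ((linkGraph K v).neighborSet x).ncard = 2

/-- A coherent orientation of the triangles of `K`: a choice of a sign for each ordered triangle,
alternating in the order of the vertices, such that two triangles sharing the edge `[x y]` induce
opposite orientations on it. -/
structure IsCoherentOrientation [Fintype V] (K : AbstractSimplicialComplex V)
    (o : Chains K 2) : Prop where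
  sign_eq : ∀ x y z : V, {x, y, z} ∈ triangles K → o.1 ![x, y, z] = 1 ∨ o.1 ![x, y, z] = -1
  coherent : ∀ w w' x y : V, w ≠ w' → {w, x, y} ∈ triangles K → {w', x, y} ∈ triangles K →
    o.1 ![w, x, y] = -o.1 ![w', x, y]

/-- `K` triangulates the closed connected orientable surface of genus `g`; the genus is half of the
first Betti number. -/
structure IsOrientableSurface [Fintype V] (K : AbstractSimplicialComplex V) (g : ℕ) : Prop where
  closedSurface : IsClosedSurface K
  orientable : ∃ o : Chains K 2, IsCoherentOrientation K o
  betti_one : Module.finrank ℤ (Homology K 1) = 2 * g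

/-- `a` generates `H₂(K; ℤ)`; for a triangulated closed orientable surface, where `H₂(K; ℤ) ≅ ℤ`,
such an `a` is the fundamental class of one of the two orientations of `K`. -/
def IsFundamentalClass [Fintype V] (K : AbstractSimplicialComplex V) (a : Homology K 2) : Prop :=
  Submodule.span ℤ {a} = ⊤

end Surface

/-! ### The 7-vertex torus -/

/-- The 14 triangles of the 7-vertex torus; the element `i` of `Fin 7` is the vertex `vᵢ₊₁`. -/
def torusTriangles : Finset (Finset (Fin 7)) :=
  {{0, 1, 3}, {1, 3, 4}, {1, 2, 4}, {2, 4, 5}, {0, 4, 5}, {0, 1, 5}, {1, 5, 6},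
   {1, 2, 6}, {0, 2, 6}, {0, 4, 6}, {3, 4, 6}, {3, 5, 6}, {2, 3, 5}, {0, 2, 3}}

/-- The 7-vertex triangulation of the torus. -/
def torus7 : AbstractSimplicialComplex (Fin 7) where
  faces := {s | s.Nonempty ∧ ∃ t ∈ torusTriangles, s ⊆ t}
  isRelLowerSet_faces := by
    rintro s ⟨hs, t, ht, hst⟩
    exact ⟨hs, fun u hu hne => ⟨hne, t, ht, hu.trans hst⟩⟩
  singleton_mem := fun v => ⟨Finset.singleton_nonempty v, by revert v; decide⟩

end TriSurf

/-! Two facts about a closed surface with a coherent orientation `o` carry both halves. Every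
2-cycle is a multiple of `o` (`IsCoherentOrientation.exists_smul`), so the fundamental classes are
±`o` and degrees can be read off on chains. And V - E + T = 2 - b₁ with 2E = 3T gives 2b₁ + 2V = 4 +
T (`IsCoherentOrientation.euler`).

Minimality: the coefficient of the image chain at a triangle of the torus is ±d and is a sum of
signs ±1 over triangles lying above, so each of the 14 triangles has at least |d| preimages
(`IsCoherentOrientation.mul_le_ncard`). The Euler relation turns this into the bound on vertices.

Existence: the surface is a cover of the torus with |d| sheets, branched only over the vertex 0.
Away from 0 such a cover is given by two permutations A, B of the sheets, since the punctured torus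
has free fundamental group on two generators; the vertices above 0 are the cycles of the commutator
A⁻¹BAB⁻¹. There are 6|d| other vertices, so |d| + 2 - 2g cycles are needed. A commutator that is a
single (2g-1)-cycle fixing all other sheets has that many, and here |d| ≥ 2g - 1 enters. On
ℤ/(2g-1), the reflections -x and 1 - x have as commutator a translation by 2, which is one cycle
because 2g - 1 is odd. The other sheets are joined by composing the second reflection with a cycle
through 0 and all of them; this cycle commutes with -x, so the commutator does not change
(`perm_commutator`), while the action becomes transitive (`perm_transitive`).

The cover is made explicit by a table of edge voltages (`voltage`) and assembled in
`exists_surface_of_perms`. The sign of d is absorbed into the orientation of K. -/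

namespace TriSurf

open Finset

/-! ### Chain groups are free on the faces -/

section ChainBasis
variable {V : Type*} [DecidableEq V]

theorem image_comp_perm {ι : Type*} [Fintype ι] (e : ι → V) (σ : Equiv.Perm ι) :
    univ.image (e ∘ σ) = univ.image e := by
  ext x
  simp only [mem_image, mem_univ, true_and, Function.comp]
  exact (σ.surjective.exists (p := fun i => e i = x)).symm

/-- The elementary chain of the oriented simplex `[e₀ … eₙ]`. -/
def simplexChain (K : AbstractSimplicialComplex V) {n : ℕ} (e : Fin (n + 1) → V)
    (he : univ.image e ∈ K.faces) : Chains K n :=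
  ⟨fun v => ∑ σ : Equiv.Perm (Fin (n + 1)), if v = e ∘ σ then (Equiv.Perm.sign σ : ℤ) else 0, by
    refine ⟨fun τ v => ?_, fun v hv => ?_⟩
    · rw [Finset.mul_sum]
      refine Fintype.sum_equiv (Equiv.mulRight τ⁻¹) _ _ fun σ => ?_
      have h : v ∘ τ = e ∘ σ ↔ v = e ∘ (σ * τ⁻¹ : Equiv.Perm (Fin (n + 1))) := by
        constructor
        · intro h
          funext i
          simpa using congrFun h (τ⁻¹ i)
        · rintro rfl
          funext i
          simp
      change _ = _ * if v = e ∘ (σ * τ⁻¹ : Equiv.Perm (Fin (n + 1))) then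
        (Equiv.Perm.sign (σ * τ⁻¹) : ℤ) else 0
      by_cases hv : v ∘ τ = e ∘ σ
      · rw [if_pos hv, if_pos (h.1 hv), Equiv.Perm.sign_mul, Equiv.Perm.sign_inv,
          mul_comm (Equiv.Perm.sign σ), Units.val_mul, ← mul_assoc, Int.units_coe_mul_self, one_mul]
      · rw [if_neg hv, if_neg (fun h' => hv (h.2 h')), mul_zero]
    · obtain ⟨σ, -, hσ⟩ := Finset.exists_ne_zero_of_sum_ne_zero hv
      split_ifs at hσ with h
      · subst h
        rwa [image_comp_perm]
      · exact absurd rfl hσ⟩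

theorem simplexChain_apply (K : AbstractSimplicialComplex V) {n : ℕ} (e : Fin (n + 1) → V)
    (he : univ.image e ∈ K.faces) (v : Fin (n + 1) → V) :
    (simplexChain K e he).1 v =
      ∑ σ : Equiv.Perm (Fin (n + 1)), if v = e ∘ σ then (Equiv.Perm.sign σ : ℤ) else 0 := rfl

theorem simplexChain_self (K : AbstractSimplicialComplex V) {n : ℕ} (e : Fin (n + 1) → V)
    (he : univ.image e ∈ K.faces) (hinj : Function.Injective e) :
    (simplexChain K e he).1 e = 1 := by
  rw [simplexChain_apply, Finset.sum_eq_single 1]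
  · simp
  · intro σ _ hσ
    rw [if_neg]
    intro h
    refine hσ (Equiv.ext fun i => hinj ?_)
    simpa using (congrFun h i).symm
  · simp

theorem simplexChain_of_image_ne (K : AbstractSimplicialComplex V) {n : ℕ} (e : Fin (n + 1) → V)
    (he : univ.image e ∈ K.faces) {v : Fin (n + 1) → V} (hv : univ.image v ≠ univ.image e) :
    (simplexChain K e he).1 v = 0 := by
  rw [simplexChain_apply]
  refine Finset.sum_eq_zero fun σ _ => if_neg ?_
  rintro rfl
  exact hv (image_comp_perm e σ)

theorem exists_enum {n : ℕ} {s : Finset V} (hs : s.card = n + 1) :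
    ∃ e : Fin (n + 1) → V, Function.Injective e ∧ univ.image e = s := by
  refine ⟨fun i => ((s.equivFinOfCardEq hs).symm i).1, fun i j h => ?_, ?_⟩
  · exact (s.equivFinOfCardEq hs).symm.injective (Subtype.ext h)
  · ext x
    simp only [mem_image, mem_univ, true_and]
    constructor
    · rintro ⟨i, rfl⟩
      exact Subtype.coe_prop _
    · intro hx
      exact ⟨s.equivFinOfCardEq hs ⟨x, hx⟩, by simp⟩

theorem exists_perm_of_image_eq {n : ℕ} {e v : Fin (n + 1) → V} (hv : Function.Injective v)
    (h : univ.image v = univ.image e) :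
    ∃ σ : Equiv.Perm (Fin (n + 1)), v = e ∘ σ := by
  have h1 : ∀ i, ∃ j, e j = v i := by
    intro i
    have : v i ∈ univ.image e := h ▸ mem_image_of_mem v (mem_univ i)
    simpa using this
  choose f hf using h1
  have hinj : Function.Injective f := fun i j hij => hv (by rw [← hf i, ← hf j, hij])
  refine ⟨Equiv.ofBijective f (Finite.injective_iff_bijective.1 hinj), ?_⟩
  funext i
  exact (hf i).symm

/-- The faces of `K` of dimension `n`. -/
abbrev nFaces (K : AbstractSimplicialComplex V) (n : ℕ) : Type _ :=
  {s : Finset V // s ∈ K.faces ∧ s.card = n + 1}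

/-- Evaluation at one chosen ordering of each face is an isomorphism onto the integer functions on
`n`-faces: the alternating property gives injectivity, the elementary chains give surjectivity. -/
theorem finrank_chains [Fintype V] (K : AbstractSimplicialComplex V) (n : ℕ) :
    Module.finrank ℤ (Chains K n) = Nat.card (nFaces K n) := by
  classical
  choose e he hes using fun s : nFaces K n => exists_enum s.2.2
  let F : Chains K n →ₗ[ℤ] (nFaces K n → ℤ) :=
    { toFun := fun c s => c.1 (e s)
      map_add' := fun a b => rfl
      map_smul' := fun r a => rfl }
  have hinj : Function.Injective F := by
    rw [← LinearMap.ker_eq_bot, LinearMap.ker_eq_bot']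
    intro c hc
    ext v
    change c.1 v = 0
    by_contra hv
    have hvi : Function.Injective v := by
      by_contra h
      exact hv (eq_zero_of_not_injective c h)
    have hf := c.2.2 v hv
    have hcard : (univ.image v).card = n + 1 := by
      rw [Finset.card_image_of_injective _ hvi, Finset.card_univ, Fintype.card_fin]
    obtain ⟨σ, hσ⟩ := exists_perm_of_image_eq hvi (hes ⟨_, hf, hcard⟩).symm
    apply hv
    have h0 : c.1 (e ⟨_, hf, hcard⟩) = 0 := congrFun hc ⟨_, hf, hcard⟩
    have h1 := c.2.1 σ (e ⟨_, hf, hcard⟩)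
    rw [h0, mul_zero] at h1
    exact (congrArg c.1 hσ).trans h1
  have hsurj : Function.Surjective F := by
    intro φ
    refine ⟨∑ s, φ s • simplexChain K (e s) (by rw [hes]; exact s.2.1), ?_⟩
    rw [map_sum]
    funext t
    rw [Finset.sum_apply, Finset.sum_eq_single t]
    · change φ t * (simplexChain K (e t) _).1 (e t) = φ t
      rw [simplexChain_self _ _ _ (he t), mul_one]
    · intro s _ hst
      change φ s * (simplexChain K (e s) _).1 (e t) = 0
      rw [simplexChain_of_image_ne, mul_zero]
      rw [hes, hes]
      exact fun h => hst (Subtype.ext h.symm)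
    · simp
  rw [(LinearEquiv.ofBijective F ⟨hinj, hsurj⟩).finrank_eq, Module.finrank_fintype_fun_eq_card,
    Nat.card_eq_fintype_card]

end ChainBasis

/-! ### Two-chains and two-cycles on a closed surface -/

section Triple
variable {V : Type*} [DecidableEq V]

theorem image_vec3 (x y z : V) : univ.image ![x, y, z] = {x, y, z} := by
  ext w
  simp [Fin.exists_fin_succ, eq_comm]

theorem Chains.swap01 {K : AbstractSimplicialComplex V} (c : Chains K 2) (x y z : V) :
    c.1 ![y, x, z] = -c.1 ![x, y, z] := by
  have h := c.2.1 (Equiv.swap 0 1) ![x, y, z]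
  rw [Equiv.Perm.sign_swap (by decide)] at h
  have h2 : (![x, y, z] : Fin 3 → V) ∘ (Equiv.swap 0 1 : Equiv.Perm (Fin 3)) = ![y, x, z] := by
    funext i
    fin_cases i <;> rfl
  rw [h2] at h
  simpa using h

theorem Chains.swap12 {K : AbstractSimplicialComplex V} (c : Chains K 2) (x y z : V) :
    c.1 ![x, z, y] = -c.1 ![x, y, z] := by
  have h := c.2.1 (Equiv.swap 1 2) ![x, y, z]
  rw [Equiv.Perm.sign_swap (by decide)] at h
  have h2 : (![x, y, z] : Fin 3 → V) ∘ (Equiv.swap 1 2 : Equiv.Perm (Fin 3)) = ![x, z, y] := by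
    funext i
    fin_cases i <;> rfl
  rw [h2] at h
  simpa using h

theorem mem_triangles_of_apply_ne_zero {K : AbstractSimplicialComplex V} (c : Chains K 2) {v : Fin 3 → V}
    (h : c.1 v ≠ 0) : univ.image v ∈ triangles K := by
  refine ⟨c.2.2 v h, ?_⟩
  have : Function.Injective v := by
    by_contra hv
    exact h (eq_zero_of_not_injective c hv)
  rw [Finset.card_image_of_injective _ this, Finset.card_univ, Fintype.card_fin]

theorem vec3_eta {V : Type*} (v : Fin 3 → V) : v = ![v 0, v 1, v 2] := by
  funext i
  fin_cases i <;> rfl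

theorem ne_of_mem_triangles {K : AbstractSimplicialComplex V} {x y z : V}
    (h : {x, y, z} ∈ triangles K) : x ≠ y ∧ x ≠ z ∧ y ≠ z := by
  have := h.2
  refine ⟨?_, ?_, ?_⟩ <;> rintro rfl
  · have h2 : ({x, x, z} : Finset V).card ≤ 2 := by
      rw [Finset.insert_idem]; exact Finset.card_le_two
    omega
  · have h2 : ({x, y, x} : Finset V).card ≤ 2 := by
      rw [Finset.pair_comm, Finset.insert_idem]; exact Finset.card_le_two
    omega
  · have h2 : ({x, y, y} : Finset V).card ≤ 2 := by
      rw [Finset.pair_eq_singleton]; exact Finset.card_le_two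
    omega

theorem mem_triangles_of_ne {K : AbstractSimplicialComplex V} {x y z : V} (h : {x, y, z} ∈ K.faces)
    (hxy : x ≠ y) (hxz : x ≠ z) (hyz : y ≠ z) : {x, y, z} ∈ triangles K :=
  ⟨h, Finset.card_eq_three.2 ⟨x, y, z, hxy, hxz, hyz, rfl⟩⟩

theorem pair_mem_faces {K : AbstractSimplicialComplex V} {x y z : V} (h : {x, y, z} ∈ K.faces) :
    {x, y} ∈ K.faces :=
  (K.isRelLowerSet_faces h).2
    (show ({x, y} : Finset V) ⊆ {x, y, z} by intro w; simp; tauto) (by simp)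

theorem triple_rotate (x y z : V) : ({x, y, z} : Finset V) = {z, x, y} := by
  ext w; simp; tauto

theorem triple_swap01 (x y z : V) : ({x, y, z} : Finset V) = {y, x, z} := by
  ext w; simp; tauto

theorem triple_swap12 (x y z : V) : ({x, y, z} : Finset V) = {x, z, y} := by
  ext w; simp; tauto

variable [Fintype V] {K : AbstractSimplicialComplex V}

/-- Every edge of a closed surface lies in exactly two triangles. -/
theorem IsClosedSurface.exists_two (hK : IsClosedSurface K) {x y : V} (hxy : x ≠ y)
    (h : {x, y} ∈ K.faces) :
    ∃ w w', w ≠ w' ∧ ∀ z, {z, x, y} ∈ triangles K ↔ z = w ∨ z = w' := by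
  obtain ⟨w, w', hne, hw⟩ := Set.ncard_eq_two.1 (hK.link_degree x ⟨y, hxy.symm, h⟩)
  refine ⟨w.1, w'.1, fun e => hne (Subtype.ext e), fun z => ?_⟩
  have key : ∀ u : {u : V // u ≠ x ∧ {x, u} ∈ K.faces},
      {u.1, x, y} ∈ triangles K ↔ u = w ∨ u = w' := by
    intro u
    have h1 : u ∈ (linkGraph K x).neighborSet ⟨y, hxy.symm, h⟩ ↔ u = w ∨ u = w' := by
      rw [hw]; simp
    rw [← h1]
    constructor
    · intro ht
      have := ne_of_mem_triangles ht
      refine ⟨fun e => this.2.1 (by rw [← e]), ?_⟩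
      have h2 := ht.1
      rw [triple_rotate, triple_rotate, ] at h2
      exact h2
    · rintro ⟨hne, ht⟩
      refine mem_triangles_of_ne ?_ u.2.1 (fun e => hne (Subtype.ext e.symm)) hxy
      rw [triple_rotate] at ht
      exact ht
  constructor
  · intro ht
    have hne := ne_of_mem_triangles ht
    have hz : z ≠ x ∧ {x, z} ∈ K.faces := ⟨hne.1, by
      have := pair_mem_faces ht.1
      rwa [Finset.pair_comm] at this⟩
    rcases (key ⟨z, hz⟩).1 ht with e | e
    · exact Or.inl (congrArg Subtype.val e)
    · exact Or.inr (congrArg Subtype.val e)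
  · rintro (rfl | rfl)
    · exact (key w).2 (Or.inl rfl)
    · exact (key w').2 (Or.inr rfl)

theorem boundary_two_apply (c : Chains K 2) (v : Fin 2 → V) :
    (boundary K 1 c).1 v = ∑ w, c.1 ![w, v 0, v 1] := by
  change ∑ w, c.1 (Fin.cons w v) = _
  refine Finset.sum_congr rfl fun w _ => congrArg c.1 ?_
  funext i
  fin_cases i <;> rfl

theorem sum_two (c : Chains K 2) {x y w w' : V} (hne : w ≠ w')
    (h : ∀ z, {z, x, y} ∈ triangles K ↔ z = w ∨ z = w') :
    ∑ z, c.1 ![z, x, y] = c.1 ![w, x, y] + c.1 ![w', x, y] := by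
  rw [← Finset.sum_pair hne (f := fun z => c.1 ![z, x, y])]
  refine (Finset.sum_subset (Finset.subset_univ _) fun z _ hz => ?_).symm
  by_contra h0
  have := mem_triangles_of_apply_ne_zero c h0
  rw [image_vec3, h] at this
  simp only [mem_insert, mem_singleton] at hz
  exact hz this

/-- The boundary at an edge has only two terms, one for each triangle containing it, and coherence
makes them cancel. -/
theorem IsCoherentOrientation.mem_cycles (hK : IsClosedSurface K) {o : Chains K 2}
    (ho : IsCoherentOrientation K o) : o ∈ cycles K 2 := by
  change boundary K 1 o = 0
  ext v
  rw [boundary_two_apply]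
  change _ = (0 : ℤ)
  by_cases hv : v 0 ≠ v 1 ∧ {v 0, v 1} ∈ K.faces
  · obtain ⟨w, w', hne, h⟩ := hK.exists_two hv.1 hv.2
    rw [sum_two o hne h, ho.coherent w w' _ _ hne ((h w).2 (Or.inl rfl)) ((h w').2 (Or.inr rfl)),
      neg_add_cancel]
  · refine Finset.sum_eq_zero fun w _ => ?_
    by_contra h0
    have ht := mem_triangles_of_apply_ne_zero o h0
    rw [image_vec3] at ht
    refine hv ⟨(ne_of_mem_triangles ht).2.2, ?_⟩
    have := ht.1
    rw [triple_rotate, triple_rotate] at this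
    exact pair_mem_faces this

theorem IsClosedSurface.exists_third (hK : IsClosedSurface K) {x y : V} (hxy : x ≠ y)
    (h : {x, y} ∈ K.faces) : ∃ z, {x, y, z} ∈ triangles K := by
  obtain ⟨w, w', -, hw⟩ := hK.exists_two hxy h
  exact ⟨w, by rw [triple_rotate]; exact (hw w).2 (Or.inl rfl)⟩

theorem IsClosedSurface.exists_triangle (hK : IsClosedSurface K) (x : V) :
    ∃ y z, {x, y, z} ∈ triangles K := by
  obtain ⟨y⟩ := (hK.link_connected x).nonempty
  obtain ⟨z, hz⟩ := hK.exists_third y.2.1.symm y.2.2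
  exact ⟨y.1, z, hz⟩

/-- A coherently oriented closed surface carries exactly the multiples of the orientation as
`2`-cycles. -/
theorem IsCoherentOrientation.exists_smul (hK : IsClosedSurface K) {o : Chains K 2}
    (ho : IsCoherentOrientation K o) {c : Chains K 2} (hc : c ∈ cycles K 2) :
    ∃ k : ℤ, c = k • o := by
  have hsq : ∀ x y z, {x, y, z} ∈ triangles K → o.1 ![x, y, z] * o.1 ![x, y, z] = 1 := by
    intro x y z h
    rcases ho.sign_eq x y z h with h | h <;> rw [h] <;> norm_num
  -- As `o` is ±1 on triangles, `R` is the ratio of `c` to `o`, independent of the order of the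
  -- vertices. It is shown to be constant across an edge, then around a vertex (the link is
  -- connected), then everywhere (the 1-skeleton is connected).
  let R : V → V → V → ℤ := fun x y z => c.1 ![x, y, z] * o.1 ![x, y, z]
  have R01 : ∀ x y z, R y x z = R x y z := fun x y z => by
    simp only [R, Chains.swap01 _ x y z]; ring
  have R12 : ∀ x y z, R x z y = R x y z := fun x y z => by
    simp only [R, Chains.swap12 _ x y z]; ring
  have Radj0 : ∀ w w' x y, {w, x, y} ∈ triangles K → {w', x, y} ∈ triangles K →
      R w x y = R w' x y := by
    intro u u' x y hu hu'
    by_cases huu : u = u'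
    · rw [huu]
    have hu2 := hu.1
    rw [triple_rotate, triple_rotate] at hu2
    obtain ⟨w, w', hne, h⟩ := hK.exists_two (ne_of_mem_triangles hu).2.2 (pair_mem_faces hu2)
    have hb : ∑ z, c.1 ![z, x, y] = 0 := by
      have := boundary_two_apply c ![x, y]
      rw [show boundary K 1 c = 0 from hc] at this
      exact this.symm
    have hcw : c.1 ![u, x, y] = - c.1 ![u', x, y] := by
      have h' : ∀ z, {z, x, y} ∈ triangles K ↔ z = u ∨ z = u' := by
        intro z
        rw [h]
        have h1 := (h u).1 hu
        have h2 := (h u').1 hu'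
        rcases h1 with rfl | rfl <;> rcases h2 with rfl | rfl <;> tauto
      rw [sum_two c huu h'] at hb
      linarith
    simp only [R]
    rw [hcw, ho.coherent u u' x y huu hu hu']
    ring
  have Radj : ∀ x y z z', {x, y, z} ∈ triangles K → {x, y, z'} ∈ triangles K →
      R x y z = R x y z' := by
    intro x y z z' h h'
    rw [← R12 x y z, ← R01 x z y, ← R12 x y z', ← R01 x z' y]
    exact Radj0 z z' x y (by rwa [← triple_rotate]) (by rwa [← triple_rotate])
  have Rlink : ∀ x y y' z z', {x, y, z} ∈ triangles K → {x, y', z'} ∈ triangles K →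
      R x y z = R x y' z' := by
    intro x y y' z z' h h'
    have hy := ne_of_mem_triangles h
    have hy' := ne_of_mem_triangles h'
    obtain ⟨p⟩ := (hK.link_connected x) ⟨y, hy.1.symm, pair_mem_faces h.1⟩
      ⟨y', hy'.1.symm, pair_mem_faces h'.1⟩
    have key : ∀ (a b : {u : V // u ≠ x ∧ {x, u} ∈ K.faces}) (p : (linkGraph K x).Walk a b)
        (z z' : V), {x, a.1, z} ∈ triangles K → {x, b.1, z'} ∈ triangles K →
        R x a.1 z = R x b.1 z' := by
      intro a b p
      induction p with
      | nil => intro z z' h h'; exact Radj _ _ _ _ h h'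
      | @cons a a1 b hadj p ih =>
        intro z z' h h'
        have ht : {x, a.1, a1.1} ∈ triangles K :=
          mem_triangles_of_ne hadj.2 a.2.1.symm a1.2.1.symm fun e => hadj.1 (Subtype.ext e)
        rw [Radj x a.1 z a1.1 h ht, ← R12]
        exact ih a.1 z' (by rwa [triple_swap12]) h'
    exact key _ _ p z z' h h'
  have Rall : ∀ x x', (edgeGraph K).Walk x x' → ∀ y z y' z', {x, y, z} ∈ triangles K →
      {x', y', z'} ∈ triangles K → R x y z = R x' y' z' := by
    intro x x' p
    induction p with
    | nil => intro y z y' z' h h'; exact Rlink _ _ _ _ _ h h'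
    | @cons x x1 x' hadj p ih =>
      intro y z y' z' h h'
      obtain ⟨w, hw⟩ := hK.exists_third hadj.1 hadj.2
      -- Turn about `x` to a triangle containing the edge from `x` to `x1`, then view that triangle
      -- from `x1`.
      rw [Rlink x y x1 z w h hw, ← R01]
      exact ih x w y' z' (by rwa [triple_swap01]) h'
  obtain ⟨x0⟩ := hK.connected.nonempty
  obtain ⟨y0, z0, h0⟩ := hK.exists_triangle x0
  refine ⟨R x0 y0 z0, ?_⟩
  ext v
  change c.1 v = R x0 y0 z0 * o.1 v
  rw [vec3_eta v]
  by_cases hv : {v 0, v 1, v 2} ∈ triangles K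
  · obtain ⟨p⟩ := hK.connected x0 (v 0)
    rw [Rall _ _ p _ _ _ _ h0 hv]
    simp only [R]
    rw [mul_assoc, hsq _ _ _ hv, mul_one]
  · have h1 : ∀ c : Chains K 2, c.1 ![v 0, v 1, v 2] = 0 := by
      intro c
      by_contra h
      have := mem_triangles_of_apply_ne_zero c h
      rw [image_vec3] at this
      exact hv this
    rw [h1, h1, mul_zero]

end Triple
-- Second homology and fundamental classes
section FundamentalClass
variable {V : Type*} [DecidableEq V] [Fintype V] {K : AbstractSimplicialComplex V}

/-- There are no 3-simplices, so all 3-chains vanish and classes in `H₂` can be treated as cycles.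
-/
theorem IsClosedSurface.boundaries_two (hK : IsClosedSurface K) : boundaries K 2 = ⊥ := by
  rw [boundaries, LinearMap.range_eq_bot]
  have h : ∀ c : Chains K 3, c = 0 := by
    intro c
    ext v
    change c.1 v = 0
    by_contra hv
    have hi : Function.Injective v := by
      by_contra h
      exact hv (eq_zero_of_not_injective c h)
    have := hK.card_le_three _ (c.2.2 v hv)
    rw [Finset.card_image_of_injective _ hi, Finset.card_univ, Fintype.card_fin] at this
    omega
  ext1 c
  rw [h c, map_zero, map_zero]

theorem IsClosedSurface.mk_eq_mk_iff (hK : IsClosedSurface K) (c c' : cycles K 2) :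
    (Submodule.Quotient.mk c : Homology K 2) = Submodule.Quotient.mk c' ↔ c.1 = c'.1 := by
  rw [Submodule.Quotient.eq, hK.boundaries_two, Submodule.submoduleOf, Submodule.mem_comap,
    Submodule.mem_bot, map_sub, sub_eq_zero]
  rfl

theorem IsCoherentOrientation.ne_zero (hK : IsClosedSurface K) {o : Chains K 2}
    (ho : IsCoherentOrientation K o) : o ≠ 0 := by
  obtain ⟨x⟩ := hK.connected.nonempty
  obtain ⟨y, z, h⟩ := hK.exists_triangle x
  rintro rfl
  rcases ho.sign_eq x y z h with h | h
  · exact zero_ne_one h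
  · exact absurd h (by decide : (0 : ℤ) ≠ -1)

/-- The 2-cycles form the infinite cyclic group generated by `o`, whose only generators are ±`o`. -/
theorem IsCoherentOrientation.isFundamentalClass_iff (hK : IsClosedSurface K) {o : Chains K 2}
    (ho : IsCoherentOrientation K o) (a : Homology K 2) :
    IsFundamentalClass K a ↔
      ∃ ε : ℤ, (ε = 1 ∨ ε = -1) ∧
        a = Submodule.Quotient.mk (ε • (⟨o, ho.mem_cycles hK⟩ : cycles K 2)) := by
  constructor
  · intro ha
    obtain ⟨⟨c, hc⟩, rfl⟩ := Submodule.Quotient.mk_surjective _ a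
    obtain ⟨l, rfl⟩ := ho.exists_smul hK hc
    have h1 : (Submodule.Quotient.mk ⟨o, ho.mem_cycles hK⟩ : Homology K 2) ∈
        Submodule.span ℤ {(Submodule.Quotient.mk ⟨l • o, hc⟩ : Homology K 2)} := by
      rw [show Submodule.span ℤ {(Submodule.Quotient.mk ⟨l • o, hc⟩ : Homology K 2)} = ⊤ from ha]
      trivial
    obtain ⟨k, hk⟩ := Submodule.mem_span_singleton.1 h1
    rw [← Submodule.Quotient.mk_smul, hK.mk_eq_mk_iff] at hk
    have hk' : (k * l) • o = (1 : ℤ) • o := by rw [mul_smul, one_smul]; exact hk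
    have hkl : k * l = 1 := smul_left_injective ℤ (ho.ne_zero hK) hk'
    refine ⟨l, Int.isUnit_iff.1 (IsUnit.of_mul_eq_one k (by rw [mul_comm]; exact hkl)), ?_⟩
    rw [hK.mk_eq_mk_iff]
    rfl
  · rintro ⟨ε, hε, rfl⟩
    refine Submodule.eq_top_iff'.2 fun x => ?_
    obtain ⟨⟨c, hc⟩, rfl⟩ := Submodule.Quotient.mk_surjective _ x
    obtain ⟨l, rfl⟩ := ho.exists_smul hK hc
    refine Submodule.mem_span_singleton.2 ⟨l * ε, ?_⟩
    rw [← Submodule.Quotient.mk_smul, hK.mk_eq_mk_iff]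
    change (l * ε) • ε • o = l • o
    rw [← mul_smul, mul_assoc]
    rcases hε with rfl | rfl <;> simp

theorem homologyMap_mk {W : Type*} [DecidableEq W] [Fintype W] {L : AbstractSimplicialComplex W}
    (f : SimplicialMap K L) (n : ℕ) (c : cycles K n) :
    f.homologyMap n (Submodule.Quotient.mk c) = Submodule.Quotient.mk (f.cyclesMap n c) := rfl

theorem hasDegree_mk_iff {W : Type*} [DecidableEq W] [Fintype W] {L : AbstractSimplicialComplex W}
    (hL : IsClosedSurface L) (f : SimplicialMap K L) (a : cycles K 2) (b : cycles L 2) (d : ℤ) :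
    f.HasDegree (Submodule.Quotient.mk a) (Submodule.Quotient.mk b) d ↔
      f.chainMap 2 a.1 = d • b.1 := by
  rw [SimplicialMap.HasDegree, homologyMap_mk, ← Submodule.Quotient.mk_smul, hL.mk_eq_mk_iff]
  rfl

end FundamentalClass

/-! ### Euler characteristic and first Betti number -/

section Euler
variable {V : Type*} [DecidableEq V] [Fintype V] {K : AbstractSimplicialComplex V}

theorem finrank_range_add_finrank_ker_int {M N : Type*} [AddCommGroup M] [AddCommGroup N]
    [Module.Finite ℤ M] (f : M →ₗ[ℤ] N) :
    Module.finrank ℤ (LinearMap.range f) + Module.finrank ℤ (LinearMap.ker f) =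
      Module.finrank ℤ M := by
  rw [← f.quotKerEquivRange.finrank_eq, Submodule.finrank_quotient_add_finrank]

theorem IsCoherentOrientation.finrank_ker (hK : IsClosedSurface K) {o : Chains K 2}
    (ho : IsCoherentOrientation K o) :
    Module.finrank ℤ (LinearMap.ker (boundary K 1)) = 1 := by
  let F : ℤ →ₗ[ℤ] LinearMap.ker (boundary K 1) :=
    LinearMap.toSpanSingleton ℤ _ ⟨o, ho.mem_cycles hK⟩
  have hF : Function.Bijective F := by
    constructor
    · intro k l h
      exact smul_left_injective ℤ (ho.ne_zero hK) (congrArg Subtype.val h)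
    · rintro ⟨c, hc⟩
      obtain ⟨k, rfl⟩ := ho.exists_smul hK hc
      exact ⟨k, rfl⟩
  rw [← (LinearEquiv.ofBijective F hF).finrank_eq, Module.finrank_self]

variable (K) in
/-- The `0`-chain of a vertex. -/
def pointChain (x : V) : Chains K 0 :=
  simplexChain K ![x] (by simpa using K.singleton_mem x)

omit [Fintype V] in
theorem pointChain_apply (x : V) (v : Fin 1 → V) :
    (pointChain K x).1 v = if v 0 = x then 1 else 0 := by
  rw [pointChain, simplexChain_apply]
  change ∑ σ : Equiv.Perm (Fin 1), _ = _
  rw [Fintype.sum_unique]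
  have : v = ![x] ∘ (default : Equiv.Perm (Fin 1)) ↔ v 0 = x := by
    constructor
    · intro h
      rw [h]
      simp
    · intro h
      funext i
      rw [show i = 0 from Fin.fin_one_eq_zero i, h]
      rfl
  simp only [this]
  simp

theorem boundary_edge {x y : V} (h : {x, y} ∈ K.faces) :
    boundary K 0 (simplexChain K ![x, y] (by simpa [Fin.univ_succ] using h)) =
      pointChain K y - pointChain K x := by
  ext v
  change ∑ w, (simplexChain K ![x, y] _).1 (Fin.cons w v) =
    (pointChain K y).1 v - (pointChain K x).1 v
  have key : ∀ w, (simplexChain K ![x, y] (by simpa [Fin.univ_succ] using h)).1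
      (Fin.cons w v : Fin 2 → V) =
      (if w = x then (if v 0 = y then 1 else 0) else 0) -
        (if w = y then (if v 0 = x then 1 else 0) else 0) := by
    intro w
    rw [simplexChain_apply, show (univ : Finset (Equiv.Perm (Fin 2))) = {1, Equiv.swap 0 1} by decide,
      Finset.sum_pair (by decide)]
    have h1 : (Fin.cons w v : Fin 2 → V) = ![x, y] ∘ (1 : Equiv.Perm (Fin 2)) ↔
        w = x ∧ v 0 = y := by
      simp [funext_iff, Fin.forall_fin_succ]
    have h2 : (Fin.cons w v : Fin 2 → V) = ![x, y] ∘ (Equiv.swap 0 1 : Equiv.Perm (Fin 2)) ↔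
        w = y ∧ v 0 = x := by
      simp [funext_iff, Fin.forall_fin_succ]
    simp only [h1, h2, Equiv.Perm.sign_swap (show (0 : Fin 2) ≠ 1 by decide)]
    simp only [ite_and, Equiv.Perm.sign_one, Units.val_one, Units.val_neg]
    split_ifs <;> simp
  rw [Finset.sum_congr rfl fun w _ => key w, Finset.sum_sub_distrib, pointChain_apply,
    pointChain_apply]
  simp

theorem pointChain_sub_mem (hK : IsClosedSurface K) (x y : V) :
    pointChain K y - pointChain K x ∈ LinearMap.range (boundary K 0) := by
  obtain ⟨p⟩ := hK.connected x y
  induction p with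
  | nil => simp
  | @cons a b c hadj p ih =>
    have := Submodule.add_mem _ ih ⟨_, boundary_edge hadj.2⟩
    rwa [sub_add_sub_cancel] at this

variable (K) in
/-- The augmentation of the `0`-chains. -/
def augmentation : Chains K 0 →ₗ[ℤ] ℤ where
  toFun c := ∑ x, c.1 ![x]
  map_add' a b := by simp [Finset.sum_add_distrib]
  map_smul' r a := by simp [Finset.mul_sum]

theorem augmentation_pointChain (x : V) : augmentation K (pointChain K x) = 1 := by
  change ∑ y, (pointChain K x).1 ![y] = 1
  simp [pointChain_apply]

/-- A 0-chain of augmentation zero is a combination of differences of a vertex and a base point, and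
each difference bounds a path in the connected 1-skeleton. -/
theorem IsClosedSurface.range_boundary_zero (hK : IsClosedSurface K) :
    LinearMap.range (boundary K 0) = LinearMap.ker (augmentation K) := by
  apply le_antisymm
  · rintro _ ⟨c, rfl⟩
    rw [LinearMap.mem_ker]
    change ∑ x, ∑ w, c.1 (Fin.cons w ![x]) = 0
    have hs : ∀ x w : V, c.1 (Fin.cons w ![x]) = - c.1 (Fin.cons x ![w]) := by
      intro x w
      have h := c.2.1 (Equiv.swap 0 1) (Fin.cons x ![w])
      rw [Equiv.Perm.sign_swap (by decide)] at h
      have h2 : (Fin.cons x ![w] : Fin 2 → V) ∘ (Equiv.swap 0 1 : Equiv.Perm (Fin 2)) =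
          Fin.cons w ![x] := by
        funext i
        fin_cases i <;> rfl
      rw [h2] at h
      simpa using h
    have h : ∑ x, ∑ w, c.1 (Fin.cons w ![x]) = - ∑ x, ∑ w, c.1 (Fin.cons w ![x]) := by
      conv_lhs => rw [Finset.sum_comm]
      rw [← Finset.sum_neg_distrib]
      refine Finset.sum_congr rfl fun u _ => ?_
      rw [← Finset.sum_neg_distrib]
      exact Finset.sum_congr rfl fun w _ => hs w u
    omega
  · intro c hc
    obtain ⟨x0⟩ := hK.connected.nonempty
    have h : c = ∑ x, c.1 ![x] • (pointChain K x - pointChain K x0) +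
        augmentation K c • pointChain K x0 := by
      simp only [smul_sub, Finset.sum_sub_distrib, ← Finset.sum_smul]
      change _ = _ - augmentation K c • _ + _
      rw [sub_add_cancel]
      ext v
      change _ = (∑ x, c.1 ![x] • pointChain K x : Chains K 0).1 v
      rw [Submodule.coe_sum, Finset.sum_apply]
      change _ = ∑ x, c.1 ![x] * (pointChain K x).1 v
      simp only [pointChain_apply, mul_ite, mul_one, mul_zero, Finset.sum_ite_eq, mem_univ, if_true]
      refine congrArg c.1 (funext fun i => ?_)
      rw [show i = 0 from Fin.fin_one_eq_zero i]
      rfl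
    rw [LinearMap.mem_ker] at hc
    rw [h, hc, zero_smul, add_zero]
    exact Submodule.sum_mem _ fun x _ => Submodule.smul_mem _ _ (pointChain_sub_mem hK _ _)

theorem IsClosedSurface.finrank_range_boundary_zero (hK : IsClosedSurface K) :
    Module.finrank ℤ (LinearMap.range (boundary K 0)) + 1 = Module.finrank ℤ (Chains K 0) := by
  have hr : LinearMap.range (augmentation K) = ⊤ := by
    obtain ⟨x0⟩ := hK.connected.nonempty
    refine LinearMap.range_eq_top.2 fun k => ⟨k • pointChain K x0, ?_⟩
    rw [map_smul, augmentation_pointChain, smul_eq_mul, mul_one]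
  have := finrank_range_add_finrank_ker_int (augmentation K)
  rw [hr, finrank_top, Module.finrank_self] at this
  rw [hK.range_boundary_zero]
  omega

omit [DecidableEq V] in
variable (K) in
theorem card_nFaces_zero : Nat.card (nFaces K 0) = Fintype.card V := by
  rw [← Nat.card_eq_fintype_card]
  refine (Nat.card_congr (Equiv.ofBijective
    (fun x : V => (⟨{x}, K.singleton_mem x, by simp⟩ : nFaces K 0)) ⟨?_, ?_⟩)).symm
  · intro x y h
    exact Finset.singleton_injective (congrArg Subtype.val h)
  · rintro ⟨s, hs, hc⟩
    obtain ⟨x, rfl⟩ := Finset.card_eq_one.1 hc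
    exact ⟨x, rfl⟩

/-- Double counting of incidences: two triangles on each edge, three edges in each triangle. -/
theorem IsClosedSurface.card_edges (hK : IsClosedSurface K) :
    Nat.card (nFaces K 1) * 2 = Nat.card (nFaces K 2) * 3 := by
  classical
  have hc : ∀ n, Nat.card (nFaces K n) =
      #(univ.filter fun s : Finset V => s ∈ K.faces ∧ s.card = n + 1) := by
    intro n
    rw [Nat.card_eq_fintype_card, Fintype.card_subtype]
  rw [hc, hc]
  refine Finset.card_mul_eq_card_mul (fun s t => s ⊆ t) ?_ ?_
  · intro e he
    obtain ⟨hef, hec⟩ := (Finset.mem_filter.1 he).2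
    obtain ⟨x, y, hxy, rfl⟩ := Finset.card_eq_two.1 hec
    obtain ⟨w, w', hne, h⟩ := hK.exists_two hxy hef
    have hw := (h w).2 (Or.inl rfl)
    have hw' := (h w').2 (Or.inr rfl)
    have e : Finset.bipartiteAbove (fun s t => s ⊆ t)
        (univ.filter fun s : Finset V => s ∈ K.faces ∧ s.card = 2 + 1) {x, y} =
        {{w, x, y}, {w', x, y}} := by
      ext t
      simp only [Finset.mem_bipartiteAbove, mem_filter, mem_univ, true_and, mem_insert,
        mem_singleton]
      constructor
      · rintro ⟨⟨ht, htc⟩, hs⟩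
        obtain ⟨z, -, rfl⟩ := Finset.exists_eq_insert_iff.2 ⟨hs, by rw [hec, htc]⟩
        rcases (h z).1 ⟨ht, htc⟩ with rfl | rfl
        · exact Or.inl rfl
        · exact Or.inr rfl
      · rintro (rfl | rfl)
        · exact ⟨hw, Finset.subset_insert _ _⟩
        · exact ⟨hw', Finset.subset_insert _ _⟩
    rw [e, Finset.card_pair]
    intro heq
    have : w ∈ ({w', x, y} : Finset V) := heq ▸ Finset.mem_insert_self _ _
    have h1 := ne_of_mem_triangles hw
    simp only [mem_insert, mem_singleton] at this
    tauto
  · intro t ht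
    obtain ⟨htf, htc⟩ := (Finset.mem_filter.1 ht).2
    have e : Finset.bipartiteBelow (fun s t => s ⊆ t)
        (univ.filter fun s : Finset V => s ∈ K.faces ∧ s.card = 1 + 1) t = t.powersetCard 2 := by
      ext s
      simp only [Finset.mem_bipartiteBelow, mem_filter, mem_univ, true_and,
        Finset.mem_powersetCard]
      constructor
      · rintro ⟨⟨-, h1⟩, h2⟩
        exact ⟨h2, h1⟩
      · rintro ⟨h2, h1⟩
        exact ⟨⟨(K.isRelLowerSet_faces htf).2 h2 (Finset.card_pos.1 (by omega)), h1⟩, h2⟩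
    rw [e, Finset.card_powersetCard, htc]
    rfl

omit [DecidableEq V] [Fintype V] in
theorem ncard_triangles : (triangles K).ncard = Nat.card (nFaces K 2) := rfl

/-- The Euler characteristic of a closed orientable surface, in terms of its first Betti number. -/
theorem IsCoherentOrientation.euler (hK : IsClosedSurface K) {o : Chains K 2}
    (ho : IsCoherentOrientation K o) :
    2 * Module.finrank ℤ (Homology K 1) + 2 * Fintype.card V = 4 + (triangles K).ncard := by
  have h1 : Module.finrank ℤ (Homology K 1) +
      Module.finrank ℤ (LinearMap.range (boundary K 1)) =
        Module.finrank ℤ (LinearMap.ker (boundary K 0)) := by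
    have h := Submodule.finrank_quotient_add_finrank
      ((boundaries K 1).submoduleOf (cycles K 1))
    rw [(Submodule.submoduleOfEquivOfLe (boundaries_le_cycles K 1)).finrank_eq] at h
    exact h
  have h2 := finrank_range_add_finrank_ker_int (boundary K 1)
  have h3 := finrank_range_add_finrank_ker_int (boundary K 0)
  have h4 := ho.finrank_ker hK
  have h5 := hK.finrank_range_boundary_zero
  have h6 := hK.card_edges
  have h7 := card_nFaces_zero K
  rw [finrank_chains] at h2 h3 h5
  rw [ncard_triangles]
  -- The relations are b₁ + rk ∂₂ = rk ker ∂₁, rk ∂₂ = T - 1, rk ∂₁ = V - 1 and 2E = 3T; it remains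
  -- to eliminate E.
  simp only [Nat.reduceAdd] at *
  omega

end Euler

/-! ### Degree and numbers of preimages -/

section Degree
variable {V W : Type*} [DecidableEq V] [Fintype V] [DecidableEq W] [Fintype W]
  {K : AbstractSimplicialComplex V} {L : AbstractSimplicialComplex W}

theorem IsCoherentOrientation.abs_le_one {o : Chains K 2} (ho : IsCoherentOrientation K o)
    (v : Fin 3 → V) : |o.1 v| ≤ if o.1 v = 0 then 0 else 1 := by
  split_ifs with h
  · rw [h, abs_zero]
  · have := mem_triangles_of_apply_ne_zero o h
    rw [vec3_eta v, image_vec3] at this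
    rw [vec3_eta v]
    rcases ho.sign_eq _ _ _ this with h | h <;> rw [h] <;> simp

/-- A chain map image `k • oL` of a coherent orientation forces `|k|` triangles above each triangle
of the target. -/
theorem IsCoherentOrientation.mul_le_ncard {oK : Chains K 2} (hoK : IsCoherentOrientation K oK)
    {oL : Chains L 2} (hoL : IsCoherentOrientation L oL) (f : SimplicialMap K L) {k : ℤ}
    (h : f.chainMap 2 oK = k • oL) :
    ((triangles L).ncard : ℤ) * |k| ≤ (triangles K).ncard := by
  classical
  set TK := univ.filter fun s : Finset V => s ∈ triangles K with hTK
  set TL := univ.filter fun s : Finset W => s ∈ triangles L with hTL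
  have cK : (triangles K).ncard = #TK := by
    rw [← Set.ncard_coe_finset]; congr 1; ext; simp [hTK]
  have cL : (triangles L).ncard = #TL := by
    rw [← Set.ncard_coe_finset]; congr 1; ext; simp [hTL]
  have fiber : ∀ t ∈ TL, |k| ≤ (#(TK.filter fun s => s.image f.toFun = t) : ℤ) := by
    intro t ht
    have ht : t ∈ triangles L := (Finset.mem_filter.1 ht).2
    -- With a fixed ordering `w` of the target triangle, the coefficient there is a sum of terms ±1
    -- or 0 over ordered lifts of `w`, so at least `|k|` lifts contribute.
    obtain ⟨w, hw, hwt⟩ := exists_enum (n := 2) ht.2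
    have h1 : ∑ v : Fin 3 → V, (if f.toFun ∘ v = w then oK.1 v else 0) = k * oL.1 w :=
      congrFun (congrArg Subtype.val h) w
    have h2 : |oL.1 w| = 1 := by
      rw [← hwt, vec3_eta w, image_vec3] at ht
      rw [vec3_eta w]
      rcases hoL.sign_eq _ _ _ ht with h | h <;> rw [h] <;> simp
    have h3 : |k| = |k * oL.1 w| := by rw [abs_mul, h2, mul_one]
    rw [h3, ← h1]
    refine (Finset.abs_sum_le_sum_abs _ _).trans ?_
    have h4 : ∀ v : Fin 3 → V, |if f.toFun ∘ v = w then oK.1 v else 0| ≤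
        if f.toFun ∘ v = w ∧ oK.1 v ≠ 0 then 1 else 0 := by
      intro v
      have := hoK.abs_le_one v
      by_cases a : f.toFun ∘ v = w <;> by_cases b : oK.1 v = 0 <;> simp_all
    refine (Finset.sum_le_sum fun v _ => h4 v).trans ?_
    rw [Finset.sum_boole]
    norm_cast
    -- Different ordered lifts span different triangles: a permutation of one lift over the same
    -- injective `w` must be trivial.
    refine Finset.card_le_card_of_injOn (fun v => univ.image v) ?_ ?_
    · intro v hv
      simp only [coe_filter, mem_univ, true_and, Set.mem_ofPred_eq] at hv
      simp only [coe_filter, Set.mem_ofPred_eq, hTK, mem_filter, mem_univ, true_and]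
      refine ⟨mem_triangles_of_apply_ne_zero oK hv.2, ?_⟩
      rw [Finset.image_image, hv.1, hwt]
    · intro v hv v' hv' hvv
      simp only [coe_filter, mem_univ, true_and, Set.mem_ofPred_eq] at hv hv'
      have hi : Function.Injective v := by
        by_contra hn
        exact hv.2 (eq_zero_of_not_injective oK hn)
      obtain ⟨σ, rfl⟩ := exists_perm_of_image_eq hi hvv
      have : ∀ i, σ i = i := by
        intro i
        apply hw
        have h1 := congrFun hv.1 i
        have h2 := congrFun hv'.1 (σ i)
        simp only [Function.comp] at h1 h2
        rw [← h1, ← h2]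
      funext i
      simp [this]
  rw [cK, cL]
  have h5 : #(TK.filter fun s => s.image f.toFun ∈ TL) =
      ∑ t ∈ TL, #((TK.filter fun s => s.image f.toFun ∈ TL).filter fun s => s.image f.toFun = t) :=
    Finset.card_eq_sum_card_fiberwise fun s hs => (Finset.mem_filter.1 hs).2
  have h6 : (#TL : ℤ) * |k| ≤ ∑ t ∈ TL, (#((TK.filter fun s => s.image f.toFun ∈ TL).filter
      fun s => s.image f.toFun = t) : ℤ) := by
    rw [← nsmul_eq_mul]
    refine Finset.card_nsmul_le_sum _ _ _ fun t ht => (fiber t ht).trans ?_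
    norm_cast
    refine Finset.card_le_card fun s hs => ?_
    simp only [mem_filter] at hs ⊢
    exact ⟨⟨hs.1, hs.2 ▸ ht⟩, hs.2⟩
  refine h6.trans ?_
  rw [← Nat.cast_sum, ← h5]
  exact_mod_cast Finset.card_le_card (Finset.filter_subset _ _)

/-- A map of nonzero degree is onto. -/
theorem IsCoherentOrientation.isOnto {oK : Chains K 2}
    {oL : Chains L 2} (hoL : IsCoherentOrientation L oL) (f : SimplicialMap K L) {k : ℤ}
    (hk : k ≠ 0) (h : f.chainMap 2 oK = k • oL)
    (hL : ∀ t ∈ L.faces, ∃ s ∈ triangles L, t ⊆ s) : f.IsOnto := by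
  intro t ht
  obtain ⟨s, hs, hts⟩ := hL t ht
  obtain ⟨w, hw, rfl⟩ := exists_enum (n := 2) hs.2
  have h1 : ∑ v : Fin 3 → V, (if f.toFun ∘ v = w then oK.1 v else 0) = k * oL.1 w :=
    congrFun (congrArg Subtype.val h) w
  have h2 : oL.1 w ≠ 0 := by
    rw [vec3_eta w, image_vec3] at hs
    rw [vec3_eta w]
    rcases hoL.sign_eq _ _ _ hs with h | h <;> rw [h] <;> simp
  obtain ⟨v, -, hv⟩ := Finset.exists_ne_zero_of_sum_ne_zero (h1.trans_ne (mul_ne_zero hk h2))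
  split_ifs at hv with hvw
  · have himg : (univ.image v).image f.toFun = univ.image w := by
      rw [Finset.image_image, hvw]
    obtain ⟨u, hu, rfl⟩ := Finset.subset_image_iff.1 (himg.symm ▸ hts)
    exact ⟨u, (K.isRelLowerSet_faces (oK.2.2 v hv)).2 (by exact_mod_cast hu)
      (Finset.image_nonempty.1 (L.isRelLowerSet_faces ht).1), rfl⟩
  · exact absurd rfl hv

/-- The given fundamental classes may differ from the chosen orientations by signs, hence only `|k|`
is determined. -/
theorem IsCoherentOrientation.exists_chainMap_eq (hK : IsClosedSurface K) (hL : IsClosedSurface L)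
    {oK : Chains K 2} (hoK : IsCoherentOrientation K oK)
    {oL : Chains L 2} (hoL : IsCoherentOrientation L oL) {f : SimplicialMap K L}
    {a : Homology K 2} {b : Homology L 2} (ha : IsFundamentalClass K a)
    (hb : IsFundamentalClass L b) {d : ℤ} (h : f.HasDegree a b d) :
    ∃ k : ℤ, |k| = |d| ∧ f.chainMap 2 oK = k • oL := by
  obtain ⟨ε, hε, rfl⟩ := (hoK.isFundamentalClass_iff hK a).1 ha
  obtain ⟨δ, hδ, rfl⟩ := (hoL.isFundamentalClass_iff hL b).1 hb
  rw [hasDegree_mk_iff hL] at h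
  change f.chainMap 2 (ε • oK) = d • δ • oL at h
  rw [map_smul, ← mul_smul] at h
  refine ⟨ε * (d * δ), ?_, ?_⟩
  · rcases hε with rfl | rfl <;> rcases hδ with rfl | rfl <;> simp
  · rw [mul_smul, ← h, ← mul_smul]
    rcases hε with rfl | rfl <;> simp

end Degree
-- The 7-vertex torus and the lower bounds
section Torus

theorem torus7_pair_mem (x y : Fin 7) : {x, y} ∈ torus7.faces := by
  refine ⟨by simp, ?_⟩
  revert x y
  decide +kernel

/-- The triangulation is invariant under translations of ℤ/7, and in the link of `x` the successor
of `y` is `x + 3(y - x)`. This arithmetic form replaces the list of triangles from here on. -/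
theorem torus7_triple_mem_iff {x y z : Fin 7} (hxy : x ≠ y) (hxz : x ≠ z) (hyz : y ≠ z) :
    {x, y, z} ∈ torus7.faces ↔ z = 3 * y - 2 * x ∨ y = 3 * z - 2 * x := by
  have h : ∀ x y z : Fin 7, x ≠ y → x ≠ z → y ≠ z →
      ((∃ t ∈ torusTriangles, ({x, y, z} : Finset (Fin 7)) ⊆ t) ↔
        z = 3 * y - 2 * x ∨ y = 3 * z - 2 * x) := by
    decide +kernel
  rw [← h x y z hxy hxz hyz]
  exact and_iff_right (by simp)

theorem torus7_triangles : triangles torus7 = (torusTriangles : Set (Finset (Fin 7))) := by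
  have hc : ∀ t ∈ torusTriangles, t.Nonempty ∧ #t = 3 := by decide +kernel
  ext s
  constructor
  · rintro ⟨⟨-, t, ht, hst⟩, hs⟩
    rwa [Finset.eq_of_subset_of_card_le hst (by rw [hs, (hc t ht).2])]
  · intro hs
    exact ⟨⟨(hc s hs).1, s, hs, subset_rfl⟩, (hc s hs).2⟩

theorem ncard_torus7_triangles : (triangles torus7).ncard = 14 := by
  rw [torus7_triangles, Set.ncard_coe_finset]
  decide +kernel

theorem torus7_exists_triangle {t : Finset (Fin 7)} (ht : t ∈ torus7.faces) :
    ∃ s ∈ triangles torus7, t ⊆ s := by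
  obtain ⟨-, s, hs, hts⟩ := ht
  exact ⟨s, by rwa [torus7_triangles, Finset.mem_coe], hts⟩

theorem torus7_card_le_three {s : Finset (Fin 7)} (hs : s ∈ torus7.faces) : s.card ≤ 3 := by
  obtain ⟨t, ht, hst⟩ := torus7_exists_triangle hs
  exact (Finset.card_le_card hst).trans ht.2.le

theorem torus7_third_ne {x y : Fin 7} (hxy : x ≠ y) :
    3 * y - 2 * x ≠ x ∧ 3 * y - 2 * x ≠ y ∧ 5 * (y - x) + x ≠ x ∧ 5 * (y - x) + x ≠ y ∧
      3 * y - 2 * x ≠ 5 * (y - x) + x := by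
  revert x y
  decide +kernel

theorem torus7_exists_two {x y : Fin 7} (hxy : x ≠ y) :
    ∃ w w', w ≠ w' ∧ w ≠ x ∧ w ≠ y ∧ w' ≠ x ∧ w' ≠ y ∧
      ∀ z, z ≠ x → z ≠ y → ({x, y, z} ∈ torus7.faces ↔ z = w ∨ z = w') := by
  obtain ⟨h1, h2, h3, h4, h5⟩ := torus7_third_ne hxy
  refine ⟨_, _, h5, h1, h2, h3, h4, fun z hx hy => ?_⟩
  rw [torus7_triple_mem_iff hxy hx.symm hy.symm]
  -- The two link neighbours are the successor and the predecessor; 5 is the inverse of 3 modulo 7.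
  have : y = 3 * z - 2 * x ↔ z = 5 * (y - x) + x := by
    clear * -
    revert x y z
    decide +kernel
  rw [this]

/-- Since 3 is a primitive root modulo 7, iterating the successor map in the link of `v` reaches all
six other vertices. -/
theorem torus7_link_connected (v : Fin 7) : (linkGraph torus7 v).Connected := by
  have hne : ∀ v y : Fin 7, y ≠ v → 3 * y - 2 * v ≠ v ∧ 3 * y - 2 * v ≠ y := by decide +kernel
  have step : ∀ (k : ℕ) (y : Fin 7) (hy : y ≠ v), ∃ h : (fun z => 3 * z - 2 * v)^[k] y ≠ v,
      (linkGraph torus7 v).Reachable ⟨y, hy, torus7_pair_mem v y⟩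
        ⟨(fun z => 3 * z - 2 * v)^[k] y, h, torus7_pair_mem v _⟩ := by
    intro k
    induction k with
    | zero => intro y hy; exact ⟨hy, .rfl⟩
    | succ k ih =>
      intro y hy
      obtain ⟨h, hr⟩ := ih (3 * y - 2 * v) (hne v y hy).1
      refine ⟨h, .trans (SimpleGraph.Adj.reachable ?_) hr⟩
      refine ⟨fun e => (hne v y hy).2 (congrArg Subtype.val e).symm, ?_⟩
      exact (torus7_triple_mem_iff hy.symm (hne v y hy).1.symm (hne v y hy).2.symm).2 (Or.inl rfl)
  have iter : ∀ v x y : Fin 7, y ≠ v → x ≠ v → ∃ k : Fin 6,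
      (fun z => 3 * z - 2 * v)^[k.1] y = x := by decide +kernel
  have : Nonempty {x : Fin 7 // x ≠ v ∧ {v, x} ∈ torus7.faces} :=
    ⟨⟨v + 1, by simp, torus7_pair_mem _ _⟩⟩
  refine SimpleGraph.Connected.mk fun y x => ?_
  obtain ⟨k, hk⟩ := iter v x.1 y.1 y.2.1 x.2.1
  obtain ⟨h, hr⟩ := step k y.1 y.2.1
  convert hr
  exact hk.symm

theorem isClosedSurface_torus7 : IsClosedSurface torus7 where
  card_le_three _ hs := torus7_card_le_three hs
  connected := by
    refine SimpleGraph.Connected.mk fun x y => ?_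
    by_cases h : x = y
    · rw [h]
    · exact SimpleGraph.Adj.reachable ⟨h, torus7_pair_mem x y⟩
  link_connected := torus7_link_connected
  link_degree v x := by
    obtain ⟨w, w', hne, hwv, hwx, hwv', hwx', h⟩ := torus7_exists_two x.2.1.symm
    rw [Set.ncard_eq_two]
    refine ⟨⟨w, hwv, torus7_pair_mem _ _⟩, ⟨w', hwv', torus7_pair_mem _ _⟩,
      fun e => hne (congrArg Subtype.val e), ?_⟩
    ext z
    simp only [SimpleGraph.mem_neighborSet, Set.mem_insert_iff, Set.mem_singleton_iff, Subtype.ext_iff]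
    constructor
    · rintro ⟨hxz, ht⟩
      exact (h z.1 z.2.1 fun e => hxz (Subtype.ext e.symm)).1 ht
    · intro hz
      have hxz : z.1 ≠ x.1 := by rcases hz with e | e <;> rw [e] <;> assumption
      exact ⟨fun e => hxz (congrArg Subtype.val e).symm, (h z.1 z.2.1 hxz).2 hz⟩

/-- The sign of an ordered triple in the orientation of the 7-vertex torus whose positive triangles
are the `[x, y, 3y - 2x]`. -/
def torusSign (x y z : Fin 7) : ℤ :=
  -- The first branch is needed because `3y - 2x = x` when `x = y`, so that `[x, x, x]` would get
  -- sign 1; the other repetitions reach the final 0.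
  if x = y then 0 else if z = 3 * y - 2 * x then 1 else if y = 3 * z - 2 * x then -1 else 0

/-- The orientation of the 7-vertex torus. -/
def torusOrientation : Chains torus7 2 :=
  ⟨fun v => torusSign (v 0) (v 1) (v 2), by
    refine ⟨fun σ => ?_, fun v hv => ?_⟩
    · induction σ using Equiv.Perm.swap_induction_on with
      | one => simp
      | swap_mul σ i j hij ih =>
        intro v
        have h := ih (v ∘ Equiv.swap i j)
        rw [Function.comp_assoc] at h
        rw [Equiv.Perm.coe_mul, h, Equiv.Perm.sign_mul, Equiv.Perm.sign_swap hij]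
        have key : ∀ x y z : Fin 7, torusSign y x z = -torusSign x y z ∧
            torusSign z y x = -torusSign x y z ∧ torusSign x z y = -torusSign x y z := by
          decide +kernel
        obtain ⟨h1, h2, h3⟩ := key (v 0) (v 1) (v 2)
        have hs : torusSign ((v ∘ Equiv.swap i j) 0) ((v ∘ Equiv.swap i j) 1)
            ((v ∘ Equiv.swap i j) 2) = -torusSign (v 0) (v 1) (v 2) := by
          fin_cases i <;> fin_cases j <;> first | exact absurd rfl hij | exact h1 | exact h2 |
            exact h3
        change _ * torusSign _ _ _ = _ * torusSign _ _ _
        rw [hs]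
        simp
    · have key : ∀ x y z : Fin 7, torusSign x y z ≠ 0 →
          ∃ t ∈ torusTriangles, ({x, y, z} : Finset (Fin 7)) ⊆ t := by decide +kernel
      rw [vec3_eta v, image_vec3]
      exact ⟨by simp, key _ _ _ hv⟩⟩

theorem torusOrientation_apply (x y z : Fin 7) :
    torusOrientation.1 ![x, y, z] = torusSign x y z := rfl

theorem torusOrientation_coherent : IsCoherentOrientation torus7 torusOrientation where
  sign_eq x y z h := by
    have hne := ne_of_mem_triangles h
    have := (torus7_triple_mem_iff hne.1 hne.2.1 hne.2.2).1 h.1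
    rw [torusOrientation_apply, torusSign, if_neg hne.1]
    split_ifs <;> tauto
  coherent w w' x y hww h h' := by
    have hne := ne_of_mem_triangles h
    have hne' := ne_of_mem_triangles h'
    have h1 := (torus7_triple_mem_iff hne.1 hne.2.1 hne.2.2).1 h.1
    have h2 := (torus7_triple_mem_iff hne'.1 hne'.2.1 hne'.2.2).1 h'.1
    rw [torusOrientation_apply, torusOrientation_apply]
    have key : ∀ w w' x y : Fin 7, w ≠ w' → w ≠ x → w' ≠ x →
        (y = 3 * x - 2 * w ∨ x = 3 * y - 2 * w) → (y = 3 * x - 2 * w' ∨ x = 3 * y - 2 * w') →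
        torusSign w x y = -torusSign w' x y := by
      decide +kernel
    exact key w w' x y hww hne.1 hne'.1 h1 h2

theorem isOrientableSurface_torus7 : IsOrientableSurface torus7 1 where
  closedSurface := isClosedSurface_torus7
  orientable := ⟨_, torusOrientation_coherent⟩
  betti_one := by
    -- Counting replaces a computation of `H₁`: 2b₁ + 2·7 = 4 + 14.
    have := torusOrientation_coherent.euler isClosedSurface_torus7
    rw [ncard_torus7_triangles, Fintype.card_fin] at this
    omega

/-- Lower bounds for a degree `d` map from a surface of genus `g` to the 7-vertex torus. -/
theorem torus7_minimality {V : Type*} [Fintype V] [DecidableEq V] {K : AbstractSimplicialComplex V}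
    {g : ℕ} {d : ℤ} (hK : IsOrientableSurface K g) {a : Homology K 2} {b : Homology torus7 2}
    (ha : IsFundamentalClass K a) (hb : IsFundamentalClass torus7 b) {f : SimplicialMap K torus7}
    (hf : f.HasDegree a b d) :
    14 * |d| ≤ ((triangles K).ncard : ℤ) ∧ 7 * |d| + 2 - 2 * (g : ℤ) ≤ (Fintype.card V : ℤ) := by
  obtain ⟨o, ho⟩ := hK.orientable
  obtain ⟨k, hk, h⟩ := ho.exists_chainMap_eq hK.closedSurface isClosedSurface_torus7
    torusOrientation_coherent ha hb hf
  have h1 := ho.mul_le_ncard torusOrientation_coherent f h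
  rw [ncard_torus7_triangles, hk] at h1
  have h2 := ho.euler hK.closedSurface
  rw [hK.betti_one] at h2
  push_cast at h1
  omega

end Torus
-- Pullback of chains
section Pullback
variable {V W : Type*} [DecidableEq V] [DecidableEq W]
  {K : AbstractSimplicialComplex V} {L : AbstractSimplicialComplex W}

open Classical in
/-- The chain on `K` whose value on each simplex is that of `c` on its image. -/
noncomputable def SimplicialMap.pullback (f : SimplicialMap K L) {n : ℕ} (c : Chains L n) :
    Chains K n :=
  ⟨fun v => if univ.image v ∈ K.faces then c.1 (f.toFun ∘ v) else 0, by
    refine ⟨fun σ v => ?_, fun v hv => ?_⟩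
    · change (if univ.image (v ∘ σ) ∈ K.faces then c.1 ((f.toFun ∘ v) ∘ σ) else 0) = _ * ite _ _ _
      rw [image_comp_perm, c.2.1 σ]
      split_ifs <;> simp
    · by_contra h
      exact hv (if_neg h)⟩

theorem SimplicialMap.pullback_apply (f : SimplicialMap K L) {n : ℕ} (c : Chains L n)
    {v : Fin (n + 1) → V} (hv : univ.image v ∈ K.faces) :
    (f.pullback c).1 v = c.1 (f.toFun ∘ v) := if_pos hv

theorem SimplicialMap.pullback_apply_of_notMem (f : SimplicialMap K L) {n : ℕ} (c : Chains L n)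
    {v : Fin (n + 1) → V} (hv : univ.image v ∉ K.faces) : (f.pullback c).1 v = 0 := if_neg hv

end Pullback

/-! ### Covers of the torus branched over the vertex 0 -/

section Cover
variable {W : Type*} [DecidableEq W]

/-- The complex on `W` whose simplices are the sets of pairwise adjacent vertices lying above a
simplex of the 7-vertex torus. -/
def coverComplex (cov : W → Fin 7) (adj : W → W → Prop) : AbstractSimplicialComplex W where
  faces := {s | s.Nonempty ∧ s.image cov ∈ torus7.faces ∧ ∀ u ∈ s, ∀ v ∈ s, u ≠ v → adj u v}
  isRelLowerSet_faces := by
    rintro s ⟨hs, hi, ha⟩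
    exact ⟨hs, fun t hts hne => ⟨hne, (torus7.isRelLowerSet_faces hi).2
      (Finset.image_subset_image hts) (hne.image cov),
      fun u hu v hv => ha u (hts hu) v (hts hv)⟩⟩
  singleton_mem := fun v => by
    refine ⟨Finset.singleton_nonempty v, ?_, ?_⟩
    · rw [Finset.image_singleton]
      exact torus7.singleton_mem _
    · intro u hu w hw h
      rw [Finset.mem_singleton.1 hu, Finset.mem_singleton.1 hw] at h
      exact absurd rfl h

/-- The local conditions making `coverComplex cov adj` a covering of the 7-vertex torus away from
the vertices above `0`. -/
structure IsBranchedCover (cov : W → Fin 7) (adj : W → W → Prop) : Prop where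
  symm : ∀ {u v}, adj u v → adj v u
  cov_ne : ∀ {u v}, adj u v → cov u ≠ cov v
  lift : ∀ u, cov u ≠ 0 → ∀ j, j ≠ cov u → ∃ v, cov v = j ∧ adj u v
  unique : ∀ {u v v'}, cov u ≠ 0 → adj u v → adj u v' → cov v = cov v' → v = v'
  triangle : ∀ {u v w}, cov u ≠ 0 → adj u v → adj u w → cov v ≠ cov w →
    {cov u, cov v, cov w} ∈ torus7.faces → adj v w

variable {cov : W → Fin 7} {adj : W → W → Prop}

/-- The projection of a branched cover. -/
def coverProj (cov : W → Fin 7) (adj : W → W → Prop) :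
    SimplicialMap (coverComplex cov adj) torus7 :=
  ⟨cov, fun _ hs => hs.2.1⟩

namespace IsBranchedCover

omit [DecidableEq W] in
theorem ne (hc : IsBranchedCover cov adj) {u v : W} (h : adj u v) : u ≠ v :=
  fun e => hc.cov_ne h (congrArg cov e)

theorem pair_mem_iff (hc : IsBranchedCover cov adj) {u v : W} (huv : u ≠ v) :
    {u, v} ∈ (coverComplex cov adj).faces ↔ adj u v := by
  constructor
  · exact fun h => h.2.2 u (by simp) v (by simp) huv
  · intro h
    refine ⟨by simp, ?_, ?_⟩
    · rw [Finset.image_insert, Finset.image_singleton]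
      exact torus7_pair_mem _ _
    · intro x hx y hy hxy
      simp only [mem_insert, mem_singleton] at hx hy
      rcases hx with rfl | rfl <;> rcases hy with rfl | rfl
      · exact absurd rfl hxy
      · exact h
      · exact hc.symm h
      · exact absurd rfl hxy

theorem triple_mem (hc : IsBranchedCover cov adj) {u v w : W} (huv : adj u v) (huw : adj u w)
    (hvw : adj v w) (h : {cov u, cov v, cov w} ∈ torus7.faces) :
    {u, v, w} ∈ (coverComplex cov adj).faces := by
  refine ⟨by simp, ?_, ?_⟩
  · rwa [Finset.image_insert, Finset.image_insert, Finset.image_singleton]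
  · intro x hx y hy hxy
    simp only [mem_insert, mem_singleton] at hx hy
    rcases hx with rfl | rfl | rfl <;> rcases hy with rfl | rfl | rfl <;>
      first | exact absurd rfl hxy | assumption | exact hc.symm ‹_›

theorem cov_triple_mem {u v w : W} (h : {u, v, w} ∈ (coverComplex cov adj).faces) :
    {cov u, cov v, cov w} ∈ torus7.faces := by
  have := h.2.1
  rwa [Finset.image_insert, Finset.image_insert, Finset.image_singleton] at this

omit [DecidableEq W] in
theorem adj_of_mem {s : Finset W} (hs : s ∈ (coverComplex cov adj).faces) {u v : W} (hu : u ∈ s)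
    (hv : v ∈ s) (huv : u ≠ v) : adj u v := hs.2.2 u hu v hv huv

-- At most one end of an edge lies above 0; the other end has a star mapped bijectively to the
-- torus, which supplies the third vertex.
omit [DecidableEq W] in
theorem exists_third (hc : IsBranchedCover cov adj) {u x : W} (hux : adj u x) {k : Fin 7}
    (hku : k ≠ cov u) (hkx : k ≠ cov x) (h : {cov u, cov x, k} ∈ torus7.faces) :
    ∃ y, cov y = k ∧ adj u y ∧ adj x y := by
  by_cases h0 : cov u = 0
  · have hx0 : cov x ≠ 0 := fun e => hc.cov_ne hux (h0.trans e.symm)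
    obtain ⟨y, rfl, hy⟩ := hc.lift x hx0 k hkx
    refine ⟨y, rfl, hc.triangle hx0 (hc.symm hux) hy hku.symm ?_, hy⟩
    rwa [triple_swap01]
  · obtain ⟨y, rfl, hy⟩ := hc.lift u h0 k hku
    exact ⟨y, rfl, hy, hc.triangle h0 hux hy hkx.symm h⟩

omit [DecidableEq W] in
theorem third_unique (hc : IsBranchedCover cov adj) {u x y y' : W} (hux : adj u x)
    (huy : adj u y) (hxy : adj x y) (huy' : adj u y') (hxy' : adj x y') (h : cov y = cov y') :
    y = y' := by
  by_cases h0 : cov u = 0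
  · exact hc.unique (fun e => hc.cov_ne hux (h0.trans e.symm)) hxy hxy' h
  · exact hc.unique h0 huy huy' h

theorem injOn_cov (hc : IsBranchedCover cov adj) {s : Finset W}
    (hs : s ∈ (coverComplex cov adj).faces) : Set.InjOn cov s := by
  intro u hu v hv h
  by_contra hne
  exact hc.cov_ne (adj_of_mem hs hu hv hne) h

theorem card_image_cov (hc : IsBranchedCover cov adj) {s : Finset W}
    (hs : s ∈ (coverComplex cov adj).faces) : #(s.image cov) = #s :=
  Finset.card_image_of_injOn (hc.injOn_cov hs)

/-- Lifting neighbours through `u` maps the connected link in the torus onto the link of `u`. -/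
theorem link_connected (hc : IsBranchedCover cov adj) {u : W} (hu : cov u ≠ 0) :
    (linkGraph (coverComplex cov adj) u).Connected := by
  choose l hl hadj using hc.lift u hu
  have hne : ∀ j (hj : j ≠ cov u), l j hj ≠ u := fun j hj => (hc.ne (hadj j hj)).symm
  let F : linkGraph torus7 (cov u) →g linkGraph (coverComplex cov adj) u :=
    { toFun := fun j => ⟨l j.1 j.2.1, hne _ _, (hc.pair_mem_iff (hne _ _).symm).2 (hadj _ _)⟩
      map_rel' := by
        rintro ⟨i, hi, hi'⟩ ⟨j, hj, hj'⟩ ⟨hij, h⟩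
        have hij : i ≠ j := fun e => hij (Subtype.ext e)
        have ha : adj (l i hi) (l j hj) := hc.triangle hu (hadj _ _) (hadj _ _)
          (by rwa [hl, hl]) (by rwa [hl, hl])
        exact ⟨fun e => hc.ne ha (congrArg Subtype.val e),
          hc.triple_mem (hadj _ _) (hadj _ _) ha (by rwa [hl, hl])⟩ }
  have hF : Function.Surjective F := by
    rintro ⟨v, hv, hv'⟩
    have ha := (hc.pair_mem_iff hv.symm).1 hv'
    have hj := (hc.cov_ne ha).symm
    exact ⟨⟨cov v, hj, torus7_pair_mem _ _⟩,
      Subtype.ext (hc.unique hu (hadj _ hj) ha (hl _ hj))⟩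
  have := (torus7_link_connected (cov u)).nonempty.map F
  exact SimpleGraph.Connected.mk ((torus7_link_connected (cov u)).preconnected.map F hF)

/-- Links are 2-regular even above 0, because triangles lift uniquely along every edge. Only
connectedness, globally and of the links above 0, depends on the monodromy and has to be supplied.
-/
theorem isClosedSurface [Fintype W] (hc : IsBranchedCover cov adj)
    (hconn : (edgeGraph (coverComplex cov adj)).Connected)
    (hlink : ∀ u, cov u = 0 → (linkGraph (coverComplex cov adj) u).Connected) :
    IsClosedSurface (coverComplex cov adj) where
  card_le_three s hs := by
    rw [← hc.card_image_cov hs]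
    exact torus7_card_le_three hs.2.1
  connected := hconn
  link_connected u := by
    by_cases h : cov u = 0
    · exact hlink u h
    · exact hc.link_connected h
  link_degree := by
    rintro u ⟨x, hxu, hx⟩
    have hux := (hc.pair_mem_iff hxu.symm).1 hx
    obtain ⟨i, i', hne, hiu, hix, hiu', hix', h⟩ := torus7_exists_two (hc.cov_ne hux)
    obtain ⟨y, rfl, huy, hxy⟩ := hc.exists_third hux hiu hix ((h i hiu hix).2 (Or.inl rfl))
    obtain ⟨y', rfl, huy', hxy'⟩ := hc.exists_third hux hiu' hix' ((h i' hiu' hix').2 (Or.inr rfl))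
    rw [Set.ncard_eq_two]
    refine ⟨⟨y, (hc.ne huy).symm, (hc.pair_mem_iff (hc.ne huy)).2 huy⟩,
      ⟨y', (hc.ne huy').symm, (hc.pair_mem_iff (hc.ne huy')).2 huy'⟩,
      fun e => hne (congrArg cov (congrArg Subtype.val e)), ?_⟩
    ext ⟨z, hzu, hz⟩
    simp only [SimpleGraph.mem_neighborSet, Set.mem_insert_iff, Set.mem_singleton_iff,
      Subtype.mk.injEq]
    constructor
    · rintro ⟨hxz, ht⟩
      have hxz : x ≠ z := fun e => hxz (Subtype.ext e)
      have huz := adj_of_mem ht (by simp : u ∈ ({u, x, z} : Finset W)) (by simp : z ∈ _) hzu.symm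
      have hxz := adj_of_mem ht (by simp : x ∈ ({u, x, z} : Finset W)) (by simp : z ∈ _) hxz
      rcases (h (cov z) (hc.cov_ne huz).symm (hc.cov_ne hxz).symm).1 (cov_triple_mem ht) with e | e
      · exact Or.inl (hc.third_unique hux huz hxz huy hxy e)
      · exact Or.inr (hc.third_unique hux huz hxz huy' hxy' e)
    · rintro (rfl | rfl)
      · exact ⟨fun e => hc.ne hxy (congrArg Subtype.val e),
          hc.triple_mem hux huy hxy ((h _ hiu hix).2 (Or.inl rfl))⟩
      · exact ⟨fun e => hc.ne hxy' (congrArg Subtype.val e),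
          hc.triple_mem hux huy' hxy' ((h _ hiu' hix').2 (Or.inr rfl))⟩

theorem cov_mem_triangles (hc : IsBranchedCover cov adj) {s : Finset W}
    (hs : s ∈ triangles (coverComplex cov adj)) : s.image cov ∈ triangles torus7 :=
  ⟨hs.1.2.1, by rw [hc.card_image_cov hs.1, hs.2]⟩

theorem cov_triple_mem_triangles (hc : IsBranchedCover cov adj) {u v w : W}
    (h : {u, v, w} ∈ triangles (coverComplex cov adj)) :
    {cov u, cov v, cov w} ∈ triangles torus7 := by
  have := hc.cov_mem_triangles h
  rwa [Finset.image_insert, Finset.image_insert, Finset.image_singleton] at this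

theorem pullback_apply {u v w : W} (h : {u, v, w} ∈ (coverComplex cov adj).faces) :
    ((coverProj cov adj).pullback torusOrientation).1 ![u, v, w] =
      torusOrientation.1 ![cov u, cov v, cov w] := by
  rw [SimplicialMap.pullback_apply _ _ (by rwa [image_vec3])]
  refine congrArg _ (funext fun i => ?_)
  fin_cases i <;> rfl

/-- The projection does not fold along edges: two triangles on a common edge have distinct images,
so coherence is inherited from the torus. -/
theorem isCoherentOrientation [Fintype W] (hc : IsBranchedCover cov adj) :
    IsCoherentOrientation (coverComplex cov adj)
      ((coverProj cov adj).pullback torusOrientation) where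
  sign_eq x y z h := by
    rw [pullback_apply h.1]
    exact torusOrientation_coherent.sign_eq _ _ _ (hc.cov_triple_mem_triangles h)
  coherent w w' x y hne h h' := by
    rw [pullback_apply h.1, pullback_apply h'.1]
    refine torusOrientation_coherent.coherent _ _ _ _ (fun e => hne ?_)
      (hc.cov_triple_mem_triangles h) (hc.cov_triple_mem_triangles h')
    have n := ne_of_mem_triangles h
    have n' := ne_of_mem_triangles h'
    exact hc.third_unique
      (adj_of_mem h.1 (by simp : x ∈ ({w, x, y} : Finset W)) (by simp : y ∈ _) n.2.2)
      (adj_of_mem h.1 (by simp : x ∈ ({w, x, y} : Finset W)) (by simp : w ∈ _) n.1.symm)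
      (adj_of_mem h.1 (by simp : y ∈ ({w, x, y} : Finset W)) (by simp : w ∈ _) n.2.1.symm)
      (adj_of_mem h'.1 (by simp : x ∈ ({w', x, y} : Finset W)) (by simp : w' ∈ _) n'.1.symm)
      (adj_of_mem h'.1 (by simp : y ∈ ({w', x, y} : Finset W)) (by simp : w' ∈ _) n'.2.1.symm) e

theorem exists_triangle_lift (hc : IsBranchedCover cov adj) {t : Finset (Fin 7)}
    (ht : t ∈ triangles torus7) {u : W} (hu : cov u ≠ 0) (hut : cov u ∈ t) :
    ∃ s ∈ triangles (coverComplex cov adj), s.image cov = t ∧ u ∈ s := by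
  have h2 : #(t.erase (cov u)) = 2 := by rw [Finset.card_erase_of_mem hut, ht.2]
  obtain ⟨j, k, hjk, hjk'⟩ := Finset.card_eq_two.1 h2
  have hj : j ≠ cov u := Finset.ne_of_mem_erase (s := t) (by rw [hjk']; simp)
  have hk : k ≠ cov u := Finset.ne_of_mem_erase (s := t) (by rw [hjk']; simp)
  have hte : t = {cov u, j, k} := by rw [← hjk', Finset.insert_erase hut]
  obtain ⟨v, rfl, hv⟩ := hc.lift u hu j hj
  obtain ⟨w, rfl, hw⟩ := hc.lift u hu k hk
  have hvw := hc.triangle hu hv hw hjk (hte ▸ ht.1)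
  refine ⟨{u, v, w}, mem_triangles_of_ne (hc.triple_mem hv hw hvw (hte ▸ ht.1)) (hc.ne hv)
    (hc.ne hw) (hc.ne hvw), ?_, by simp⟩
  rw [hte, Finset.image_insert, Finset.image_insert, Finset.image_singleton]

theorem triangle_lift_unique (hc : IsBranchedCover cov adj) {s s' : Finset W}
    (hs : s ∈ triangles (coverComplex cov adj)) (hs' : s' ∈ triangles (coverComplex cov adj))
    (h : s.image cov = s'.image cov) {u : W} (hu : cov u ≠ 0) (hus : u ∈ s) (hus' : u ∈ s') :
    s = s' := by
  refine Finset.eq_of_subset_of_card_le (fun v hv => ?_) (by rw [hs.2, hs'.2])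
  by_cases hvu : v = u
  · rwa [hvu]
  have ha := adj_of_mem hs.1 hus hv (Ne.symm hvu)
  obtain ⟨v', hv', hcov⟩ := Finset.mem_image.1 (h ▸ Finset.mem_image_of_mem cov hv)
  have hne : u ≠ v' := by
    rintro rfl
    exact hc.cov_ne ha hcov
  rwa [hc.unique hu ha (adj_of_mem hs'.1 hus' hv' hne) hcov.symm]

/-- Each triangle of the torus has a vertex `i ≠ 0`, and the triangles above it correspond to the
`d` vertices above `i`. -/
theorem ncard_triangles [Fintype W] (hc : IsBranchedCover cov adj) {d : ℕ}
    (hd : ∀ i ≠ 0, #(univ.filter fun u => cov u = i) = d) :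
    (triangles (coverComplex cov adj)).ncard = 14 * d := by
  classical
  set TK := univ.filter fun s : Finset W => s ∈ triangles (coverComplex cov adj) with hTK
  have cK : (triangles (coverComplex cov adj)).ncard = #TK := by
    rw [← Set.ncard_coe_finset]; congr 1; ext; simp [hTK]
  rw [cK, Finset.card_eq_sum_card_fiberwise (f := fun s => s.image cov) (t := torusTriangles),
    Finset.sum_const_nat (m := d)]
  · congr 1
  · intro t ht
    have ht : t ∈ triangles torus7 := by rwa [torus7_triangles, Finset.mem_coe]
    obtain ⟨i, hit, hi⟩ := Finset.exists_mem_ne (s := t) (by rw [ht.2]; norm_num) 0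
    rw [← hd i hi]
    have hex : ∀ u ∈ univ.filter fun u => cov u = i,
        ∃ s ∈ triangles (coverComplex cov adj), s.image cov = t ∧ u ∈ s := by
      intro u hu
      have hu := (Finset.mem_filter.1 hu).2
      exact hc.exists_triangle_lift ht (hu ▸ hi) (hu ▸ hit)
    choose l hl hlt hul using hex
    refine (Finset.card_bij l ?_ ?_ ?_).symm
    · intro u hu
      simp only [hTK, mem_filter, mem_univ, true_and]
      exact ⟨hl u hu, hlt u hu⟩
    · intro u hu u' hu' h
      refine hc.injOn_cov (hl u hu).1 (hul u hu) (by rw [h]; exact hul u' hu') ?_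
      rw [(Finset.mem_filter.1 hu).2, (Finset.mem_filter.1 hu').2]
    · intro s hs
      simp only [hTK, mem_filter, mem_univ, true_and] at hs
      obtain ⟨u, hus, hu⟩ := Finset.mem_image.1 (hs.2.symm ▸ hit : i ∈ s.image cov)
      have hu' : u ∈ univ.filter fun u => cov u = i := by simp [hu]
      exact ⟨u, hu', hc.triangle_lift_unique (hl u hu') hs.1 ((hlt u hu').trans hs.2.symm)
        (hu ▸ hi) (hul u hu') hus⟩
  · intro s hs
    have := hc.cov_mem_triangles (Finset.mem_filter.1 hs).2
    rwa [torus7_triangles] at this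

/-- The projection of a branched cover has degree the number of sheets. -/
theorem chainMap_pullback [Fintype W] (hc : IsBranchedCover cov adj)
    (hK : IsClosedSurface (coverComplex cov adj)) {d : ℕ}
    (hd : ∀ i ≠ 0, #(univ.filter fun u => cov u = i) = d) :
    (coverProj cov adj).chainMap 2 ((coverProj cov adj).pullback torusOrientation) =
      (d : ℤ) • torusOrientation := by
  classical
  obtain ⟨k, hk⟩ := torusOrientation_coherent.exists_smul isClosedSurface_torus7
    ((coverProj cov adj).chainMap_mem_cycles 2 (hc.isCoherentOrientation.mem_cycles hK))
  rw [hk]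
  congr 1
  -- The image is a multiple of the orientation, so one coefficient determines it. `[3, 1, 4]` is a
  -- positive triangle avoiding 0; its lifts all have sign 1 and are determined by their vertex
  -- above 3.
  have h1 : ∑ v : Fin 3 → W, (if cov ∘ v = ![3, 1, 4] then
      ((coverProj cov adj).pullback torusOrientation).1 v else 0) = k * torusSign 3 1 4 :=
    congrFun (congrArg Subtype.val hk) ![3, 1, 4]
  rw [show torusSign 3 1 4 = 1 by decide, mul_one] at h1
  rw [← h1, ← hd 3 (by decide)]
  have h2 : ∀ v : Fin 3 → W, (if cov ∘ v = ![3, 1, 4] then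
      ((coverProj cov adj).pullback torusOrientation).1 v else 0) =
      if cov ∘ v = ![3, 1, 4] ∧ univ.image v ∈ (coverComplex cov adj).faces then 1 else 0 := by
    intro v
    rw [ite_and]
    refine if_ctx_congr Iff.rfl (fun hv => ?_) fun _ => rfl
    split_ifs with hf
    · rw [SimplicialMap.pullback_apply _ _ hf]
      change torusOrientation.1 (cov ∘ v) = 1
      rw [hv]
      decide
    · exact SimplicialMap.pullback_apply_of_notMem _ _ hf
  rw [Finset.sum_congr rfl fun v _ => h2 v, Finset.sum_boole]
  norm_cast
  refine Finset.card_bij (fun v _ => v 0) ?_ ?_ ?_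
  · intro v hv
    simp only [mem_filter, mem_univ, true_and] at hv ⊢
    exact congrFun hv.1 0
  · intro v hv v' hv' h
    simp only [mem_filter, mem_univ, true_and] at hv hv'
    funext i
    by_cases hi : i = 0
    · rw [hi]; exact h
    have hcov : cov (v i) = cov (v' i) := (congrFun hv.1 i).trans (congrFun hv'.1 i).symm
    have h0 : cov (v 0) = 3 := congrFun hv.1 0
    have hne : ∀ (w : Fin 3 → W), cov ∘ w = ![3, 1, 4] → w 0 ≠ w i := by
      intro w hw e
      have e' : (![3, 1, 4] : Fin 3 → Fin 7) 0 = (![3, 1, 4] : Fin 3 → Fin 7) i := by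
        rw [← hw]; exact congrArg cov e
      have hinj : ∀ i : Fin 3, i ≠ 0 → (![3, 1, 4] : Fin 3 → Fin 7) 0 ≠ ![3, 1, 4] i := by decide
      exact hinj i hi e'
    refine hc.unique (u := v 0) (by rw [h0]; decide)
      (adj_of_mem hv.2 (by simp) (by simp) (hne v hv.1)) ?_ hcov
    rw [h]
    exact adj_of_mem hv'.2 (by simp) (by simp) (hne v' hv'.1)
  · intro u hu
    have hu : cov u = 3 := (Finset.mem_filter.1 hu).2
    have hu0 : cov u ≠ 0 := by rw [hu]; decide
    obtain ⟨v, hv1, hv⟩ := hc.lift u hu0 1 (by rw [hu]; decide)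
    obtain ⟨w, hw4, hw⟩ := hc.lift u hu0 4 (by rw [hu]; decide)
    have ht : {cov u, cov v, cov w} ∈ torus7.faces := by
      rw [hu, hv1, hw4]
      exact (torus7_triple_mem_iff (by decide) (by decide) (by decide)).2 (by decide)
    have hvw := hc.triangle hu0 hv hw (by rw [hv1, hw4]; decide) ht
    refine ⟨![u, v, w], ?_, rfl⟩
    simp only [mem_filter, mem_univ, true_and]
    refine ⟨?_, by rw [image_vec3]; exact hc.triple_mem hv hw hvw ht⟩
    funext i
    fin_cases i
    · exact hu
    · exact hv1
    · exact hw4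

theorem isOrientableSurface [Fintype W] (hc : IsBranchedCover cov adj)
    (hK : IsClosedSurface (coverComplex cov adj)) {d g : ℕ}
    (hd : ∀ i ≠ 0, #(univ.filter fun u => cov u = i) = d)
    (hW : Fintype.card W + 2 * g = 7 * d + 2) :
    IsOrientableSurface (coverComplex cov adj) g where
  closedSurface := hK
  orientable := ⟨_, hc.isCoherentOrientation⟩
  betti_one := by
    have := hc.isCoherentOrientation.euler hK
    rw [hc.ncard_triangles hd] at this
    omega

end IsBranchedCover
end Cover
-- Voltages on the punctured torus
section Voltage

/-- Voltages on the edges of the 7-vertex torus describing a covering of the complement of the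
vertex `0`, whose fundamental group is free on two generators. -/
def voltage {G : Type*} [Group G] (A B : G) : Fin 7 → Fin 7 → G :=
  ![![1, 1, 1, 1, 1, 1, 1],
    ![1, 1, B⁻¹ * A, 1, A, B * A⁻¹ * B⁻¹ * A, B⁻¹ * A],
    ![1, A⁻¹ * B, 1, 1, B, B, 1],
    ![1, 1, 1, 1, A, B, A],
    ![1, A⁻¹, B⁻¹, A⁻¹, 1, 1, 1],
    ![1, A⁻¹ * B * A * B⁻¹, B⁻¹, B⁻¹, 1, 1, A * B⁻¹],
    ![1, A⁻¹ * B, 1, A⁻¹, 1, B * A⁻¹, 1]]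

variable {G : Type*} [Group G] (A B : G)

theorem voltage_zero_left (j : Fin 7) : voltage A B 0 j = 1 := by
  fin_cases j <;> rfl

theorem voltage_zero_right (i : Fin 7) : voltage A B i 0 = 1 := by
  fin_cases i <;> rfl

theorem voltage_inv (i j : Fin 7) : voltage A B j i = (voltage A B i j)⁻¹ := by
  fin_cases i <;> fin_cases j <;> simp [voltage, mul_assoc]

theorem voltage_mul_aux {i j : Fin 7} (hi : i ≠ 0) (hj : j ≠ 0) (hij : i ≠ j)
    (hk : 3 * j - 2 * i ≠ 0) :
    voltage A B j (3 * j - 2 * i) * voltage A B i j = voltage A B i (3 * j - 2 * i) := by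
  fin_cases i <;> fin_cases j <;>
    first
    | exact absurd rfl hi
    | exact absurd rfl hj
    | exact absurd rfl hij
    | exact absurd rfl hk
    | simp [voltage, mul_assoc]

/-- Flatness away from 0: the monodromy around a triangle not containing 0 is trivial. The
negatively oriented case follows from the positive one by inversion. -/
theorem voltage_mul {i j k : Fin 7} (hi : i ≠ 0) (hj : j ≠ 0) (hk : k ≠ 0) (hij : i ≠ j)
    (hik : i ≠ k) (hjk : j ≠ k) (h : {i, j, k} ∈ torus7.faces) :
    voltage A B j k * voltage A B i j = voltage A B i k := by
  rcases (torus7_triple_mem_iff hij hik hjk).1 h with rfl | rfl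
  · exact voltage_mul_aux A B hi hj hij hk
  · rw [← voltage_mul_aux A B hi hk hik hj, voltage_inv A B k, inv_mul_cancel_left]

/-- The link of 0 is the hexagon 1, 3, 2, 6, 4, 5, and the whole monodromy around 0 is concentrated
on its closing edge from 5 to 1. -/
theorem voltage_link {i : Fin 7} (hi : i ≠ 0) :
    voltage A B i (3 * i) = if i = 5 then A⁻¹ * B * A * B⁻¹ else 1 := by
  fin_cases i <;> first | exact absurd rfl hi | rfl

end Voltage

/-! ### The cover defined by two permutations -/

section VoltageCover
variable {D W : Type*} [DecidableEq W] {A B : Equiv.Perm D} {p : Fin 7 → D → W} {cov : W → Fin 7}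

/-- `p i s` is the vertex above `i` on the sheet `s` of the cover with voltages `A`, `B`. -/
structure IsSheeting (A B : Equiv.Perm D) (p : Fin 7 → D → W) (cov : W → Fin 7) : Prop where
  cov_apply : ∀ i s, cov (p i s) = i
  surj : ∀ w, ∃ s, p (cov w) s = w
  inj : ∀ i, i ≠ 0 → Function.Injective (p i)
  holonomy : ∀ s, p 0 ((A⁻¹ * B * A * B⁻¹) s) = p 0 s
  sameCycle : ∀ s t, p 0 s = p 0 t → ∃ n : ℕ, ((A⁻¹ * B * A * B⁻¹) ^ n) s = t

/-- Adjacency in the cover with voltages `A`, `B`. -/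
def voltageAdj (A B : Equiv.Perm D) (p : Fin 7 → D → W) (u v : W) : Prop :=
  ∃ i j s, i ≠ j ∧ u = p i s ∧ v = p j (voltage A B i j s)

namespace IsSheeting

omit [DecidableEq W] in
theorem adj_mk {i j : Fin 7} (hij : i ≠ j) (s : D) :
    voltageAdj A B p (p i s) (p j (voltage A B i j s)) := ⟨i, j, s, hij, rfl, rfl⟩

omit [DecidableEq W] in
theorem adj_apply (h : IsSheeting A B p cov) {i : Fin 7} (hi : i ≠ 0) {s : D} {v : W}
    (hv : voltageAdj A B p (p i s) v) : v = p (cov v) (voltage A B i (cov v) s) := by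
  obtain ⟨i', j, t, -, h1, rfl⟩ := hv
  have hii : i = i' := by rw [← h.cov_apply i s, h1, h.cov_apply]
  subst hii
  rw [h.inj i hi h1, h.cov_apply]

-- Along the link of 0 the sheet changes by the identity, the commutator or its inverse, and none of
-- these changes the vertex above 0.
omit [DecidableEq W] in
theorem apply_voltage (h : IsSheeting A B p cov) {i k : Fin 7} (hi : i ≠ 0) (hk : k ≠ 0)
    (hik : i ≠ k) (hf : {0, i, k} ∈ torus7.faces) (s : D) : p 0 (voltage A B i k s) = p 0 s := by
  have key : ∀ i, i ≠ 0 → ∀ s, p 0 (voltage A B i (3 * i) s) = p 0 s := by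
    intro i hi s
    rw [voltage_link A B hi]
    split_ifs
    · exact h.holonomy s
    · rfl
  rcases (torus7_triple_mem_iff hi.symm hk.symm hik).1 hf with e | e
  · rw [mul_zero, sub_zero] at e
    rw [e]
    exact key i hi s
  · rw [mul_zero, sub_zero] at e
    have := key k hk (voltage A B i k s)
    rw [← e, voltage_inv A B i k, ← Equiv.Perm.mul_apply, inv_mul_cancel, Equiv.Perm.one_apply] at this
    exact this.symm

omit [DecidableEq W] in
theorem isBranchedCover (h : IsSheeting A B p cov) : IsBranchedCover cov (voltageAdj A B p) where
  symm := by
    rintro u v ⟨i, j, s, hij, rfl, rfl⟩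
    refine ⟨j, i, voltage A B i j s, hij.symm, rfl, ?_⟩
    rw [voltage_inv A B i j, ← Equiv.Perm.mul_apply, inv_mul_cancel, Equiv.Perm.one_apply]
  cov_ne := by
    rintro u v ⟨i, j, s, hij, rfl, rfl⟩
    rwa [h.cov_apply, h.cov_apply]
  lift u hu j hj := by
    obtain ⟨s, hs⟩ := h.surj u
    refine ⟨p j (voltage A B (cov u) j s), h.cov_apply _ _, ?_⟩
    conv => arg 4; rw [← hs]
    exact adj_mk hj.symm s
  unique {u v v'} hu hv hv' hvv := by
    obtain ⟨s, hs⟩ := h.surj u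
    rw [← hs] at hv hv'
    rw [h.adj_apply hu hv, h.adj_apply hu hv', hvv]
  triangle {u v w} hu hv hw hvw hf := by
    have hcv : cov u ≠ cov v := by
      obtain ⟨i, j, s, hij, rfl, rfl⟩ := hv
      rwa [h.cov_apply, h.cov_apply]
    have hcw : cov u ≠ cov w := by
      obtain ⟨i, j, s, hij, rfl, rfl⟩ := hw
      rwa [h.cov_apply, h.cov_apply]
    obtain ⟨s, hs⟩ := h.surj u
    rw [← hs] at hv hw
    have ev := h.adj_apply hu hv
    have ew := h.adj_apply hu hw
    generalize cov u = i at *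
    generalize cov v = j at *
    generalize cov w = k at *
    -- In triangles through 0 the cocycle identity may fail by the commutator, so there equality is
    -- needed only after applying `p 0`.
    by_cases hj : j = 0
    · subst hj
      refine ⟨0, k, voltage A B i k s, hvw, ?_, ?_⟩
      · rw [ev, voltage_zero_right, h.apply_voltage hu hvw.symm hcw (by rwa [triple_swap01])]
        rfl
      · rw [ew, voltage_zero_left]
        rfl
    · refine ⟨j, k, voltage A B i j s, hvw, ev, ?_⟩
      rw [ew]
      by_cases hk : k = 0
      · subst hk
        rw [voltage_zero_right, voltage_zero_right]
        exact (h.apply_voltage hu hj hcv (by rwa [← triple_rotate]) s).symm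
      · rw [← Equiv.Perm.mul_apply, voltage_mul A B hu hj hk hcv hcw hvw hf]

/-- One turn around the hexagon of link edges stays above the link of 0 and advances the sheet by
the commutator. The sheets meeting at `u` form one commutator cycle, so repeated turns visit the
whole link. -/
theorem link_connected (h : IsSheeting A B p cov) {u : W} (hu : cov u = 0) :
    (linkGraph (coverComplex cov (voltageAdj A B p)) u).Connected := by
  have hc := h.isBranchedCover
  have hadj : ∀ i, i ≠ 0 → ∀ s, p 0 s = u → voltageAdj A B p u (p i s) := by
    rintro i hi s rfl
    have := adj_mk (A := A) (B := B) (p := p) hi.symm s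
    rwa [voltage_zero_left] at this
  have hmem : ∀ i, i ≠ 0 → ∀ s, p 0 s = u →
      p i s ≠ u ∧ {u, p i s} ∈ (coverComplex cov (voltageAdj A B p)).faces := fun i hi s hs =>
    ⟨(hc.ne (hadj i hi s hs)).symm,
      (hc.pair_mem_iff (hc.ne (hadj i hi s hs))).2 (hadj i hi s hs)⟩
  set L := linkGraph (coverComplex cov (voltageAdj A B p)) u with hL
  have h3 : ∀ i : Fin 7, i ≠ 0 → 3 * i ≠ 0 ∧ i ≠ 3 * i := by decide
  have step : ∀ (i : Fin 7) (hi : i ≠ 0) (s : D) (hs : p 0 s = u),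
      ∃ hs' : p 0 (voltage A B i (3 * i) s) = u, L.Reachable ⟨p i s, hmem i hi s hs⟩
        ⟨p (3 * i) (voltage A B i (3 * i) s), hmem _ (h3 i hi).1 _ hs'⟩ := by
    intro i hi s hs
    have hf : {0, i, 3 * i} ∈ torus7.faces :=
      (torus7_triple_mem_iff hi.symm (h3 i hi).1.symm (h3 i hi).2).2 (by simp)
    have hs' := (h.apply_voltage hi (h3 i hi).1 (h3 i hi).2 hf s).trans hs
    have ha := adj_mk (A := A) (B := B) (p := p) (h3 i hi).2 s
    refine ⟨hs', SimpleGraph.Adj.reachable ⟨fun e => hc.ne ha (congrArg Subtype.val e), ?_⟩⟩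
    refine hc.triple_mem (hadj i hi s hs) (hadj _ (h3 i hi).1 _ hs') ha ?_
    rwa [hu, h.cov_apply, h.cov_apply]
  have step1 : ∀ (i : Fin 7) (hi : i ≠ 0), i ≠ 5 → ∀ (s : D) (hs : p 0 s = u),
      L.Reachable ⟨p i s, hmem i hi s hs⟩ ⟨p (3 * i) s, hmem _ (h3 i hi).1 _ hs⟩ := by
    intro i hi hi5 s hs
    obtain ⟨hs', hr⟩ := step i hi s hs
    simp only [voltage_link A B hi, if_neg hi5] at hr
    exact hr
  have around : ∀ (s : D) (hs : p 0 s = u) (i : Fin 7) (hi : i ≠ 0),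
      L.Reachable ⟨p 1 s, hmem 1 (by decide) s hs⟩ ⟨p i s, hmem i hi s hs⟩ := by
    intro s hs
    have r3 := step1 1 (by decide) (by decide) s hs
    have r2 := r3.trans (step1 3 (by decide) (by decide) s hs)
    have r6 := r2.trans (step1 2 (by decide) (by decide) s hs)
    have r4 := r6.trans (step1 6 (by decide) (by decide) s hs)
    have r5 := r4.trans (step1 4 (by decide) (by decide) s hs)
    intro i hi
    fin_cases i
    · exact absurd rfl hi
    · exact .rfl
    · exact r2
    · exact r3
    · exact r4
    · exact r5
    · exact r6
  have turn : ∀ (n : ℕ) (s : D) (hs : p 0 s = u),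
      ∃ hs' : p 0 (((A⁻¹ * B * A * B⁻¹) ^ n) s) = u,
        L.Reachable ⟨p 1 s, hmem 1 (by decide) s hs⟩
          ⟨p 1 (((A⁻¹ * B * A * B⁻¹) ^ n) s), hmem 1 (by decide) _ hs'⟩ := by
    intro n
    induction n with
    | zero => intro s hs; exact ⟨hs, .rfl⟩
    | succ n ih =>
      intro s hs
      obtain ⟨h1, r1⟩ := step 5 (by decide) s hs
      have r0 := (around s hs 5 (by decide)).trans r1
      obtain ⟨h2, r2⟩ := ih _ h1
      rw [pow_succ]
      exact ⟨h2, r0.trans r2⟩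
  obtain ⟨s0, hs0⟩ := h.surj u
  rw [hu] at hs0
  have hne : Nonempty {x : W // x ≠ u ∧ {u, x} ∈
      (coverComplex cov (voltageAdj A B p)).faces} := ⟨⟨_, hmem 1 (by decide) s0 hs0⟩⟩
  rw [SimpleGraph.connected_iff_exists_forall_reachable]
  refine ⟨⟨_, hmem 1 (by decide) s0 hs0⟩, ?_⟩
  rintro ⟨x, hxu, hx⟩
  obtain ⟨i, j, s, hij, hi, rfl⟩ := (hc.pair_mem_iff hxu.symm).1 hx
  have hi0 : i = 0 := by rw [← h.cov_apply i s, ← hi, hu]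
  subst hi0
  obtain ⟨n, hn⟩ := h.sameCycle s0 s (hs0.trans hi)
  obtain ⟨h1, r1⟩ := turn n s0 hs0
  have r2 := r1.trans (around _ h1 j hij.symm)
  simp only [hn] at r2
  simp only [voltage_zero_left]
  exact r2

theorem edgeGraph_connected (h : IsSheeting A B p cov) [Nonempty D]
    (hgen : ∀ r : D → D → Prop, Equivalence r → (∀ s, r s (A s)) → (∀ s, r s (B s)) →
      ∀ s t, r s t) : (edgeGraph (coverComplex cov (voltageAdj A B p))).Connected := by
  have hc := h.isBranchedCover
  have hadj : ∀ i j : Fin 7, i ≠ j → ∀ s, (edgeGraph (coverComplex cov (voltageAdj A B p))).Reachable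
      (p i s) (p j (voltage A B i j s)) := fun i j hij s =>
    have ha := adj_mk (A := A) (B := B) (p := p) hij s
    SimpleGraph.Adj.reachable ⟨hc.ne ha, (hc.pair_mem_iff (hc.ne ha)).2 ha⟩
  have hbase : ∀ i : Fin 7, ∀ s, (edgeGraph (coverComplex cov (voltageAdj A B p))).Reachable
      (p 0 s) (p i s) := by
    intro i s
    by_cases hi : i = 0
    · rw [hi]
    · have := hadj 0 i (Ne.symm hi) s
      rwa [voltage_zero_left] at this
  -- The edges at 0 preserve the sheet label, while the edges from 3 to 4 and from 2 to 4 carry `A`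
  -- and `B`; thus transitivity connects the sheets.
  have hr := hgen
    (fun s t => (edgeGraph (coverComplex cov (voltageAdj A B p))).Reachable (p 0 s) (p 0 t))
    ⟨fun _ => .rfl, fun h => h.symm, fun h h' => h.trans h'⟩
    (fun s => ((hbase 3 s).trans (hadj 3 4 (by decide) s)).trans (hbase 4 _).symm)
    (fun s => ((hbase 2 s).trans (hadj 2 4 (by decide) s)).trans (hbase 4 _).symm)
  have : Nonempty W := ‹Nonempty D›.map (p 0)
  refine SimpleGraph.Connected.mk fun u v => ?_
  obtain ⟨s, hs⟩ := h.surj u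
  obtain ⟨t, ht⟩ := h.surj v
  rw [← hs, ← ht]
  exact ((hbase _ s).symm.trans (hr s t)).trans (hbase _ t)

omit [DecidableEq W] in
theorem card_fiber (h : IsSheeting A B p cov) [Fintype W] [Fintype D] {i : Fin 7} (hi : i ≠ 0) :
    #(univ.filter fun u => cov u = i) = Fintype.card D := by
  rw [← Finset.card_univ]
  refine (Finset.card_bij (fun s _ => p i s) ?_ ?_ ?_).symm
  · intro s _
    simp [h.cov_apply]
  · intro s _ t _ hst
    exact h.inj i hi hst
  · intro u hu
    obtain ⟨s, hs⟩ := h.surj u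
    rw [(Finset.mem_filter.1 hu).2] at hs
    exact ⟨s, mem_univ _, hs⟩

end IsSheeting

/-- A surface of genus `g` with a map of degree the number of sheets to the 7-vertex torus, from a
transitive pair of permutations of the sheets; `q` is the quotient by the cycles of the commutator. -/
theorem exists_surface_of_perms {D Q : Type*} [Fintype D] [Nonempty D] [Fintype Q]
    (A B : Equiv.Perm D) (q : D → Q) (hq : Function.Surjective q)
    (hol : ∀ s, q ((A⁻¹ * B * A * B⁻¹) s) = q s)
    (hcyc : ∀ s t, q s = q t → ∃ n : ℕ, ((A⁻¹ * B * A * B⁻¹) ^ n) s = t)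
    (hgen : ∀ r : D → D → Prop, Equivalence r → (∀ s, r s (A s)) → (∀ s, r s (B s)) →
      ∀ s t, r s t) {g : ℕ} (hg : Fintype.card Q + 2 * g = Fintype.card D + 2) :
    ∃ K : AbstractSimplicialComplex (Fin (6 * Fintype.card D + Fintype.card Q)),
      IsOrientableSurface K g ∧ ∃ o : Chains K 2, IsCoherentOrientation K o ∧
        ∃ f : SimplicialMap K torus7,
          f.chainMap 2 o = (Fintype.card D : ℤ) • torusOrientation := by
  -- Above each nonzero vertex lies a copy of `D`; above 0 lie the commutator cycles `Q`.
  let e : (Fin 6 × D) ⊕ Q ≃ Fin (6 * Fintype.card D + Fintype.card Q) :=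
    Fintype.equivFinOfCardEq (by simp)
  let p : Fin 7 → D → Fin (6 * Fintype.card D + Fintype.card Q) := fun i s =>
    e (Fin.cases (motive := fun _ => (Fin 6 × D) ⊕ Q) (.inr (q s)) (fun i => .inl (i, s)) i)
  let cov : Fin (6 * Fintype.card D + Fintype.card Q) → Fin 7 := fun w =>
    (e.symm w).elim (fun x => x.1.succ) fun _ => 0
  have hp0 : ∀ s, p 0 s = e (.inr (q s)) := fun s => rfl
  have hps : ∀ (i : Fin 6) s, p i.succ s = e (.inl (i, s)) := fun i s => rfl
  have h : IsSheeting A B p cov :=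
    { cov_apply := by
        intro i s
        refine Fin.cases ?_ (fun i => ?_) i
        · simp [cov, hp0]
        · simp [cov, hps]
      surj := by
        intro w
        obtain ⟨x, rfl⟩ := e.surjective w
        rcases x with ⟨i, s⟩ | x
        · exact ⟨s, by simp [cov, hps]⟩
        · obtain ⟨s, rfl⟩ := hq x
          exact ⟨s, by simp [cov, hp0]⟩
      inj := by
        intro i hi s t hst
        obtain ⟨i, rfl⟩ := Fin.exists_succ_eq.2 hi
        rw [hps, hps] at hst
        simpa using hst
      holonomy := fun s => by rw [hp0, hp0, hol]
      sameCycle := fun s t hst => hcyc s t (by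
        rw [hp0, hp0] at hst
        simpa using hst) }
  have hc := h.isBranchedCover
  have hK := hc.isClosedSurface (h.edgeGraph_connected hgen) fun u hu => h.link_connected hu
  refine ⟨coverComplex cov (voltageAdj A B p), hc.isOrientableSurface hK
    (fun i hi => h.card_fiber hi) ?_, _, hc.isCoherentOrientation, coverProj _ _,
    hc.chainMap_pullback hK fun i hi => h.card_fiber hi⟩
  rw [Fintype.card_fin]
  omega

end VoltageCover
-- A transitive pair whose commutator is one odd cycle
section Permutations
variable (g k : ℕ)

/-- The embedding of `Fin (k + 1)` onto `{0} ∪ Fin k` in the set of sheets. -/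
def sheetPath : Fin (k + 1) ↪ ZMod (2 * g + 1) ⊕ Fin k where
  toFun := Fin.cases (.inl 0) .inr
  inj' := by
    intro i j
    refine Fin.cases ?_ (fun i => ?_) i <;> refine Fin.cases ?_ (fun j => ?_) j <;> simp

theorem sheetPath_zero : sheetPath g k 0 = .inl 0 := rfl

theorem sheetPath_succ (i : Fin k) : sheetPath g k i.succ = .inr i := rfl

/-- The cycle through `0` and the elements of `Fin k`. -/
def sheetCycle : Equiv.Perm (ZMod (2 * g + 1) ⊕ Fin k) :=
  (finRotate (k + 1)).viaFintypeEmbedding (sheetPath g k)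

/-- The horizontal monodromy: negation on `ZMod (2g + 1)`. -/
def horizontalPerm : Equiv.Perm (ZMod (2 * g + 1) ⊕ Fin k) :=
  Equiv.sumCongr (Equiv.neg _) (Equiv.refl _)

/-- The reflection `x ↦ 1 - x` on `ZMod (2g + 1)`. -/
def reflectionPerm : Equiv.Perm (ZMod (2 * g + 1) ⊕ Fin k) :=
  Equiv.sumCongr (Equiv.subLeft 1) (Equiv.refl _)

/-- The vertical monodromy. -/
def verticalPerm : Equiv.Perm (ZMod (2 * g + 1) ⊕ Fin k) :=
  reflectionPerm g k * sheetCycle g k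

/-- The supports are disjoint: negation fixes 0 and all of `Fin k`, the only sheets that the cycle
can move. -/
theorem sheetCycle_commute : Commute (sheetCycle g k) (horizontalPerm g k) := by
  refine Equiv.Perm.Disjoint.commute fun x => ?_
  by_cases hx : x ∈ Set.range (sheetPath g k)
  · right
    obtain ⟨i, rfl⟩ := hx
    refine Fin.cases ?_ (fun i => ?_) i
    · simp [sheetPath_zero, horizontalPerm]
    · simp [sheetPath_succ, horizontalPerm]
  · left
    exact Equiv.Perm.viaFintypeEmbedding_apply_notMem_range _ _ hx

/-- The cycle cancels because it commutes with negation. Conjugating `-x` by `1 - x` gives `2 - x`,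
and a further negation gives `x - 2`. -/
theorem perm_commutator :
    (horizontalPerm g k)⁻¹ * verticalPerm g k * horizontalPerm g k * (verticalPerm g k)⁻¹ =
      Equiv.sumCongr (Equiv.subRight 2) (Equiv.refl _) := by
  have h1 : verticalPerm g k * horizontalPerm g k * (verticalPerm g k)⁻¹ =
      reflectionPerm g k * horizontalPerm g k * (reflectionPerm g k)⁻¹ := by
    rw [verticalPerm, mul_assoc (reflectionPerm g k), (sheetCycle_commute g k).eq, mul_inv_rev]
    group
  rw [mul_assoc, mul_assoc, ← mul_assoc (verticalPerm g k), h1, inv_mul_eq_iff_eq_mul,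
    mul_inv_eq_iff_eq_mul]
  ext x
  rcases x with x | i
  · simp only [horizontalPerm, reflectionPerm, Equiv.Perm.coe_mul, Function.comp,
      Equiv.sumCongr_apply, Sum.map_inl, Equiv.neg_apply, Equiv.subLeft_apply, Equiv.subRight_apply]
    congr 1
    ring
  · rfl

theorem commutator_pow_inl (n : ℕ) (x : ZMod (2 * g + 1)) :
    ((Equiv.sumCongr (Equiv.subRight 2) (Equiv.refl _) :
      Equiv.Perm (ZMod (2 * g + 1) ⊕ Fin k)) ^ n) (.inl x) = .inl (x - 2 * n) := by
  induction n generalizing x with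
  | zero => simp
  | succ n ih =>
    rw [pow_succ, Equiv.Perm.mul_apply, Equiv.sumCongr_apply, Sum.map_inl, ih]
    congr 1
    rw [Equiv.subRight_apply]
    push_cast
    ring

theorem exists_sub_two_mul (x y : ZMod (2 * g + 1)) : ∃ n : ℕ, x - 2 * n = y := by
  -- `g + 1` is the inverse of 2 modulo `2g + 1`.
  refine ⟨((x - y) * (g + 1)).val, ?_⟩
  rw [ZMod.natCast_val, ZMod.cast_id]
  have : (2 * g + 1 : ZMod (2 * g + 1)) = 0 := by exact_mod_cast ZMod.natCast_self (2 * g + 1)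
  linear_combination (-(x - y)) * this

theorem perm_transitive {r : ZMod (2 * g + 1) ⊕ Fin k → ZMod (2 * g + 1) ⊕ Fin k → Prop}
    (hr : Equivalence r) (hA : ∀ s, r s (horizontalPerm g k s))
    (hB : ∀ s, r s (verticalPerm g k s)) (s t : ZMod (2 * g + 1) ⊕ Fin k) : r s t := by
  have inv : ∀ P : Equiv.Perm (ZMod (2 * g + 1) ⊕ Fin k), (∀ s, r s (P s)) → ∀ s, r s (P⁻¹ s) := by
    intro P hP s
    have := hP (P⁻¹ s)
    rw [← Equiv.Perm.mul_apply, mul_inv_cancel, Equiv.Perm.one_apply] at this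
    exact hr.symm this
  have hC : ∀ s, r s (((horizontalPerm g k)⁻¹ * verticalPerm g k * horizontalPerm g k *
      (verticalPerm g k)⁻¹) s) := fun s =>
    hr.trans (hr.trans (hr.trans (inv _ hB s) (hA _)) (hB _)) (inv _ hA _)
  rw [perm_commutator] at hC
  have hpow : ∀ (n : ℕ) s, r s (((Equiv.sumCongr (Equiv.subRight 2) (Equiv.refl _) :
      Equiv.Perm (ZMod (2 * g + 1) ⊕ Fin k)) ^ n) s) := by
    intro n
    induction n with
    | zero => exact hr.refl
    | succ n ih =>
      intro s
      rw [pow_succ']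
      exact hr.trans (ih s) (hC _)
  have hinl : ∀ x, r (.inl 0) (.inl x) := by
    intro x
    obtain ⟨n, hn⟩ := exists_sub_two_mul g 0 x
    have := hpow n (.inl 0)
    rwa [commutator_pow_inl, hn] at this
  -- The vertical permutation moves each point of the path to the next one, since the reflection
  -- fixes `Fin k`.
  have hpath : ∀ i : Fin (k + 1), r (.inl 0) (sheetPath g k i) := by
    intro i
    induction i using Fin.induction with
    | zero => exact hr.refl _
    | succ i ih =>
      refine hr.trans ih ?_
      have := hB (sheetPath g k i.castSucc)
      rwa [verticalPerm, Equiv.Perm.mul_apply, sheetCycle,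
        Equiv.Perm.viaFintypeEmbedding_apply_image, finRotate_apply,
        Fin.coeSucc_eq_succ] at this
  have hall : ∀ s, r (.inl 0) s := by
    rintro (x | i)
    · exact hinl x
    · exact hpath i.succ
  exact hr.trans (hr.symm (hall s)) (hall t)

end Permutations

/-- Surfaces of genus `g` mapping to the 7-vertex torus with degree `2g - 1 + k`. -/
theorem exists_surface (g k : ℕ) :
    ∃ K : AbstractSimplicialComplex (Fin (6 * (2 * g + 1 + k) + (k + 1))),
      IsOrientableSurface K (g + 1) ∧ ∃ o : Chains K 2, IsCoherentOrientation K o ∧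
        ∃ f : SimplicialMap K torus7,
          f.chainMap 2 o = ((2 * g + 1 + k : ℕ) : ℤ) • torusOrientation := by
  have hD : Fintype.card (ZMod (2 * g + 1) ⊕ Fin k) = 2 * g + 1 + k := by
    rw [Fintype.card_sum, ZMod.card, Fintype.card_fin]
  have hQ : Fintype.card (Option (Fin k)) = k + 1 := by
    rw [Fintype.card_option, Fintype.card_fin]
  -- The genus is `g + 1`, so the long cycle has length `2(g + 1) - 1 = 2g + 1`. It is the class
  -- `none`; each sheet in `Fin k` is a fixed point and a class of its own.
  have := exists_surface_of_perms (horizontalPerm g k) (verticalPerm g k)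
    (Sum.elim (fun _ => none) some : _ → Option (Fin k)) ?_ ?_ ?_
    (fun r hr hA hB s t => perm_transitive g k hr hA hB s t) (g := g + 1) (by omega)
  · rwa [hD, hQ] at this
  · rintro (_ | i)
    · exact ⟨.inl 0, rfl⟩
    · exact ⟨.inr i, rfl⟩
  · rw [perm_commutator]
    rintro (x | i) <;> rfl
  · rw [perm_commutator]
    rintro (x | i) (y | j) h
    · obtain ⟨n, hn⟩ := exists_sub_two_mul g x y
      exact ⟨n, by rw [commutator_pow_inl, hn]⟩
    · cases h
    · cases h
    · cases h
      exact ⟨0, rfl⟩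

end TriSurf

/-! ### The theorem -/

open TriSurf in
theorem theorem3p2 :
    IsOrientableSurface torus7 1 ∧
    ∀ (g : ℕ) (d : ℤ), 1 ≤ g → 2 * (g : ℤ) - 1 ≤ |d| →
      -- existence, for either orientation `b` of the 7-vertex torus
      (∀ b : Homology torus7 2, IsFundamentalClass torus7 b →
        ∃ n : ℕ, (n : ℤ) = 7 * |d| + 2 - 2 * (g : ℤ) ∧
          ∃ K : AbstractSimplicialComplex (Fin n), IsOrientableSurface K g ∧
            ∃ a : Homology K 2, IsFundamentalClass K a ∧
              ∃ f : SimplicialMap K torus7, f.IsOnto ∧ f.HasDegree a b d) ∧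
      -- minimality
      (∀ (V : Type*) [Fintype V] [DecidableEq V] (K : AbstractSimplicialComplex V),
        IsOrientableSurface K g →
        ∀ (a : Homology K 2) (b : Homology torus7 2),
          IsFundamentalClass K a → IsFundamentalClass torus7 b →
          ∀ f : SimplicialMap K torus7, f.HasDegree a b d →
            14 * |d| ≤ ((triangles K).ncard : ℤ) ∧
            7 * |d| + 2 - 2 * (g : ℤ) ≤ (Fintype.card V : ℤ)) := by
  refine ⟨isOrientableSurface_torus7, fun g d hg hd => ⟨fun b hb => ?_, ?_⟩⟩
  · obtain ⟨g, rfl⟩ : ∃ g', g = g' + 1 := ⟨g - 1, by omega⟩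
    obtain ⟨k, hk⟩ : ∃ k : ℕ, |d| = ((2 * g + 1 + k : ℕ) : ℤ) :=
      ⟨(|d| - (2 * g + 1)).toNat, by push_cast at hd ⊢; omega⟩
    obtain ⟨K, hK, o, ho, f, hf⟩ := exists_surface g k
    rw [← hk] at hf
    have hd0 : |d| ≠ 0 := by push_cast at hd; omega
    obtain ⟨δ, hδ, rfl⟩ :=
      (torusOrientation_coherent.isFundamentalClass_iff isClosedSurface_torus7 b).1 hb
    -- The construction has degree `|d|` for the standard orientations; orienting `K` by `δ * η`
    -- corrects for the sign of `d` and for the prescribed orientation of the torus.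
    obtain ⟨η, hη, hηd⟩ : ∃ η : ℤ, (η = 1 ∨ η = -1) ∧ η * |d| = d := by
      rcases abs_choice d with h | h
      · exact ⟨1, Or.inl rfl, by rw [h, one_mul]⟩
      · exact ⟨-1, Or.inr rfl, by rw [h]; ring⟩
    refine ⟨_, ?_, K, hK, Submodule.Quotient.mk ((δ * η) • ⟨o, ho.mem_cycles hK.closedSurface⟩),
      (ho.isFundamentalClass_iff hK.closedSurface _).2 ⟨δ * η, ?_, rfl⟩, f, ?_, ?_⟩
    · push_cast at hk ⊢
      omega
    · rcases hδ with rfl | rfl <;> rcases hη with rfl | rfl <;> simp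
    · exact torusOrientation_coherent.isOnto f hd0 hf fun t ht => torus7_exists_triangle ht
    · rw [hasDegree_mk_iff isClosedSurface_torus7]
      change f.chainMap 2 ((δ * η) • o) = d • δ • torusOrientation
      rw [map_smul, hf, ← mul_smul, ← mul_smul, mul_assoc, hηd, mul_comm]
  · intro V _ _ K hK a b ha hb f hf
    exact torus7_minimality hK ha hb hf
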